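/- Let $d\ge 1$, let $\Omega\subset\mathbb R^d$ be a bounded open set with boundary $\partial\Omega$, and let $\theta\in\mathbb R^d$ with $|\theta|=1$. All functions are real valued. **Notation.** $W_\theta(\Omega)$ is the set of $u\in L^2(\Omega)$ for which there is $\partial_\theta u\in L^2(\Omega)$ with $\int_\Omega u\,(\theta\cdot\nabla\varphi)\,dx=-\int_\Omega(\partial_\theta u)\,\varphi\,dx$ for all $\varphi\in C_c^\infty(\Omega)$. For $x\in\Omega$ put $\delta_\theta(x)=\sup\{s\ge 0: x+t\theta\in\Omega\ \text{for all } t\in[0,s)\}$ and $\Phi_\theta(x)=x+\delta_\theta(x)\theta\in\partial\Omega$, and similarly with $-\theta$; let $\partial_\theta\Omega=\Phi_\theta(\Omega)$. For $z=\Phi_\theta(x)\in\partial_\theta\Omega$ with $x\in\Omega$ put $\Phi_{-\theta}(z)=\Phi_{-\theta}(x)$ (this does not depend on the choice of $x$) and $\ell_{-\theta}(z)=|\Phi_{-\theta}(z)-z|>0$. The directional measure is the finite Borel measure on $\partial\Omega$ given by $\mu_\theta(A)=\lambda^d(\{x\in\Omega:\Phi_\theta(x)\in A\})$; it is carried by $\partial_\theta\Omega$.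 Let $P_\theta(x)=x-(x\cdot\theta)\theta$ and, for $y\in P_\theta(\Omega)$, let $\omega_\theta(y)=\{s\in\mathbb R: s\theta+y\in\Omega\}$. A function $g:\partial\Omega\to\mathbb R$ is a directional trace of $u\in W_\theta(\Omega)$ in the direction $\theta$ if there are a representative of $u$, again denoted by $u$, and a set $A\subset P_\theta(\Omega)$ such that $P_\theta(\Omega)\setminus A$ is negligible for the $(d-1)$-dimensional Lebesgue measure of the hyperplane $\theta^\perp$ and, for every $y\in A$, the function $s\mapsto u(s\theta+y)$ belongs to $H^1(\omega_\theta(y))$ and, for every connected component $(\alpha,\beta)$ of $\omega_\theta(y)$, its representative that is continuous on $(\alpha,\beta]$ takes at $\beta$ the value $g(\beta\theta+y)$. Denote by $\gamma_\theta u$ any directional trace of $u$ in the direction $\theta$, and by $\gamma_{-\theta}u$ any directional trace of $u$ in the direction $-\theta$ (defined in the same way with $-\theta$ in place of $\theta$; note that $W_{-\theta}(\Omega)=W_\theta(\Omega)$). **Theorem (integration-by-parts formula).** Let $u,v\in W_\theta(\Omega)$. Then $u$ and $v$ have directional traces in the directions $\theta$ and $-\theta$. For every choice of these traces, the function $$z\mapsto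 \frac{\gamma_\theta u(z)\,\gamma_\theta v(z)-\gamma_{-\theta}u(\Phi_{-\theta}(z))\,\gamma_{-\theta}v(\Phi_{-\theta}(z))}{\ell_{-\theta}(z)}$$ is $\mu_\theta$-integrable on $\partial\Omega$, the function $u\,\partial_\theta v+v\,\partial_\theta u$ is integrable on $\Omega$, and $$\int_\Omega\big(u\,\partial_\theta v+v\,\partial_\theta u\big)\,dx=\int_{\partial\Omega}\frac{\gamma_\theta u(z)\,\gamma_\theta v(z)-\gamma_{-\theta}u(\Phi_{-\theta}(z))\,\gamma_{-\theta}v(\Phi_{-\theta}(z))}{\ell_{-\theta}(z)}\,d\mu_\theta(z).$$ -/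

import Mathlib

open MeasureTheory Set
open scoped ENNReal RealInnerProductSpace ContDiff

noncomputable section

namespace DirectionalTrace

/-- `ℝ^d` with its Euclidean norm. -/
abbrev E (d : ℕ) : Type := EuclideanSpace ℝ (Fin d)

/-- `L²(Ω)`, real valued, as a space of classes of functions. -/
abbrev L2 {d : ℕ} (Ω : Set (E d)) : Type := Lp ℝ 2 ((volume : Measure (E d)).restrict Ω)

/-! ### The space of functions with a directional derivative -/

/-- `C^∞_c(Ω)`: smooth functions whose support is a compact subset of `Ω`. -/
def IsTestFunction {V : Type*} [NormedAddCommGroup V] [NormedSpace ℝ V] (Ω : Set V)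
    (φ : V → ℝ) : Prop :=
  ContDiff ℝ ∞ φ ∧ HasCompactSupport φ ∧ tsupport φ ⊆ Ω

/-- `w ∈ L²(Ω)` is a weak derivative of `u ∈ L²(Ω)` in the direction `θ`. -/
def HasWeakDirDeriv {d : ℕ} (Ω : Set (E d)) (θ : E d) (u w : L2 Ω) : Prop :=
  ∀ φ : E d → ℝ, IsTestFunction Ω φ →
    ∫ x in Ω, u x * fderiv ℝ φ x θ = -∫ x in Ω, w x * φ x

/-- The space `W_θ(Ω)` of the `u ∈ L²(Ω)` such that `∂_θ u ∈ L²(Ω)`. -/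
def W {d : ℕ} (Ω : Set (E d)) (θ : E d) : Set (L2 Ω) :=
  {u | ∃ w : L2 Ω, HasWeakDirDeriv Ω θ u w}

open Classical in
/-- The weak derivative `∂_θ u` of `u ∈ W_θ(Ω)` (and `0` if `u ∉ W_θ(Ω)`). -/
def dirDeriv {d : ℕ} (Ω : Set (E d)) (θ : E d) (u : L2 Ω) : L2 Ω :=
  if h : ∃ w : L2 Ω, HasWeakDirDeriv Ω θ u w then h.choose else 0

theorem dirDeriv_spec {d : ℕ} {Ω : Set (E d)} {θ : E d} {u : L2 Ω} (hu : u ∈ W Ω θ) :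
    HasWeakDirDeriv Ω θ u (dirDeriv Ω θ u) := by
  have h : ∃ w : L2 Ω, HasWeakDirDeriv Ω θ u w := hu
  rw [dirDeriv, dif_pos h]
  exact h.choose_spec

/-- The weak derivative in the direction `θ` is unique. -/
theorem HasWeakDirDeriv.unique {d : ℕ} {Ω : Set (E d)} (hΩ : IsOpen Ω) {θ : E d} {u w₁ w₂ : L2 Ω}
    (h₁ : HasWeakDirDeriv Ω θ u w₁) (h₂ : HasWeakDirDeriv Ω θ u w₂) : w₁ = w₂ := by
  have hloc : LocallyIntegrableOn (fun x => w₁ x - w₂ x) Ω volume := by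
    have hL : LocallyIntegrable (fun x => w₁ x - w₂ x) (volume.restrict Ω) :=
      ((Lp.memLp w₁).sub (Lp.memLp w₂)).locallyIntegrable (by norm_num)
    intro x _
    obtain ⟨U, hU, hUi⟩ := hL x
    obtain ⟨V, hVU, hVo, hxV⟩ := mem_nhds_iff.1 hU
    refine ⟨Ω ∩ V, inter_mem_nhdsWithin Ω (hVo.mem_nhds hxV), ?_⟩
    have hVi := hUi.mono_set hVU
    rwa [IntegrableOn, Measure.restrict_restrict hVo.measurableSet, inter_comm] at hVi
  have key := hΩ.ae_eq_zero_of_integral_contDiff_smul_eq_zero hloc ?_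
  · refine Lp.ext ?_
    rw [Filter.EventuallyEq, ae_restrict_iff' hΩ.measurableSet]
    filter_upwards [key] with x hx hxΩ
    exact sub_eq_zero.1 (hx hxΩ)
  · intro φ h1 h2 h3
    have hφ : MemLp φ 2 ((volume : Measure (E d)).restrict Ω) :=
      (h1.continuous.memLp_of_hasCompactSupport h2).restrict Ω
    have e := (h₁ φ ⟨h1, h2, h3⟩).symm.trans (h₂ φ ⟨h1, h2, h3⟩)
    have i₁ : Integrable (fun x => w₁ x * φ x) (volume.restrict Ω) := (Lp.memLp w₁).integrable_mul hφ
    have i₂ : Integrable (fun x => w₂ x * φ x) (volume.restrict Ω) := (Lp.memLp w₂).integrable_mul hφ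
    rw [← setIntegral_eq_integral_of_forall_compl_eq_zero (s := Ω)]
    · have : ∀ x, φ x • (w₁ x - w₂ x) = w₁ x * φ x - w₂ x * φ x := fun x => by
        simp only [smul_eq_mul]; ring
      simp only [this]
      rw [integral_sub i₁ i₂]
      linarith
    · intro x hx
      rw [image_eq_zero_of_notMem_tsupport (fun h => hx (h3 h)), zero_smul]

/-! ### Chords of `Ω` in the direction `θ` -/

/-- `δ_θ(x)`, the distance from `x ∈ Ω` to the boundary along the half-line directed by `θ`. -/
def exitTime {d : ℕ} (Ω : Set (E d)) (θ x : E d) : ℝ :=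
  sSup {s : ℝ | 0 ≤ s ∧ ∀ t ∈ Ico 0 s, x + t • θ ∈ Ω}

/-- `Φ_θ(x) = x + δ_θ(x) θ`, for `x ∈ Ω`. -/
def exitPoint {d : ℕ} (Ω : Set (E d)) (θ x : E d) : E d :=
  x + exitTime Ω θ x • θ

theorem exitTime_eq {d : ℕ} {Ω : Set (E d)} {θ x : E d} {r : ℝ} (hr : 0 ≤ r)
    (h : ∀ t ∈ Ico 0 r, x + t • θ ∈ Ω) (hr' : x + r • θ ∉ Ω) : exitTime Ω θ x = r := by
  have : {s : ℝ | 0 ≤ s ∧ ∀ t ∈ Ico 0 s, x + t • θ ∈ Ω} = Icc 0 r := by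
    ext s
    refine ⟨fun hs => ⟨hs.1, ?_⟩, fun hs => ⟨hs.1, fun t ht => h t ⟨ht.1, ht.2.trans_le hs.2⟩⟩⟩
    by_contra hc
    exact hr' (hs.2 r ⟨hr, not_le.1 hc⟩)
  rw [exitTime, this, csSup_Icc hr]

theorem exitTime_spec {d : ℕ} {Ω : Set (E d)} (hΩ : IsOpen Ω) (hb : Bornology.IsBounded Ω)
    {θ : E d} (hθ : ‖θ‖ = 1) (x : E d) :
    0 ≤ exitTime Ω θ x ∧ (∀ t ∈ Ico 0 (exitTime Ω θ x), x + t • θ ∈ Ω) ∧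
      x + exitTime Ω θ x • θ ∉ Ω := by
  set T : Set ℝ := {t | 0 ≤ t ∧ x + t • θ ∉ Ω} with hT
  have hcont : Continuous fun t : ℝ => x + t • θ := by fun_prop
  have hTc : IsClosed T := isClosed_Ici.inter (hΩ.isClosed_compl.preimage hcont)
  have hTb : BddBelow T := ⟨0, fun t ht => ht.1⟩
  have hTn : T.Nonempty := by
    obtain ⟨R, hR⟩ := hb.exists_norm_le
    refine ⟨|R| + ‖x‖ + 1, by positivity, fun hc => ?_⟩
    have h1 := hR _ hc
    have h2 : ‖(|R| + ‖x‖ + 1) • θ‖ = |R| + ‖x‖ + 1 := by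
      rw [norm_smul, hθ, mul_one, Real.norm_of_nonneg (by positivity)]
    have h3 := norm_sub_le (x + (|R| + ‖x‖ + 1) • θ) x
    rw [add_sub_cancel_left, h2] at h3
    linarith [le_abs_self R]
  have hm := hTc.csInf_mem hTn hTb
  have hlt : ∀ t ∈ Ico 0 (sInf T), x + t • θ ∈ Ω := by
    intro t ht
    by_contra hc
    exact absurd (csInf_le hTb ⟨ht.1, hc⟩) (not_le.2 ht.2)
  rw [exitTime_eq hm.1 hlt hm.2]
  exact ⟨hm.1, hlt, hm.2⟩

open Classical in
/-- The extension of `Φ_{-θ}` to `∂_θ Ω = Φ_θ(Ω)`: the point `z = Φ_θ(x)`, `x ∈ Ω`, is sent to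
`Φ_{-θ}(x)`, the other end of the chord (see `oppositePoint_exitPoint`). -/
def oppositePoint {d : ℕ} (Ω : Set (E d)) (θ z : E d) : E d :=
  if h : ∃ x ∈ Ω, exitPoint Ω θ x = z then exitPoint Ω (-θ) h.choose else z

/-- `ℓ_{-θ}(z) = |ẑ - z|`, the length of the chord that ends at `z ∈ ∂_θ Ω`. -/
def chordLength {d : ℕ} (Ω : Set (E d)) (θ z : E d) : ℝ :=
  ‖oppositePoint Ω θ z - z‖

theorem exitPoint_neg_eq {d : ℕ} {Ω : Set (E d)} (hΩ : IsOpen Ω) (hb : Bornology.IsBounded Ω)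
    {θ : E d} (hθ : ‖θ‖ = 1) {x x' : E d} (hx' : x' ∈ Ω)
    (h : exitPoint Ω θ x = exitPoint Ω θ x') (hle : exitTime Ω θ x' ≤ exitTime Ω θ x) :
    exitPoint Ω (-θ) x' = exitPoint Ω (-θ) x := by
  have hθ' : ‖-θ‖ = 1 := by rwa [norm_neg]
  obtain ⟨-, a2, -⟩ := exitTime_spec hΩ hb hθ x
  obtain ⟨p0, -, -⟩ := exitTime_spec hΩ hb hθ x'
  obtain ⟨b1, b2, b3⟩ := exitTime_spec hΩ hb hθ' x
  set c := exitTime Ω θ x - exitTime Ω θ x' with hc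
  set e := exitTime Ω (-θ) x with he
  have hxx : x' = x + c • θ := by
    simp only [exitPoint] at h
    rw [hc, sub_smul, add_sub, h, add_sub_cancel_right]
  have hc0 : 0 ≤ c := sub_nonneg.2 hle
  have hmove : ∀ t : ℝ, x' + t • -θ = x + (t - c) • -θ := by
    intro t; rw [hxx]; module
  have key : exitTime Ω (-θ) x' = e + c := by
    refine exitTime_eq (by linarith) (fun t ht => ?_) ?_
    · rcases eq_or_lt_of_le ht.1 with h0 | h0
      · rw [← h0]; simpa using hx'
      · rw [hmove]
        rcases le_total t c with htc | htc
        · have := a2 (c - t) ⟨by linarith, by linarith⟩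
          convert this using 1
          module
        · exact b2 _ ⟨by linarith, by linarith [ht.2]⟩
    · rw [hmove, add_sub_cancel_right]; exact b3
  rw [exitPoint, key, hmove, add_sub_cancel_right, exitPoint]

/-- `Φ_{-θ}` on `∂_θ Ω` is well defined: it sends `Φ_θ(x)` to `Φ_{-θ}(x)`. -/
theorem oppositePoint_exitPoint {d : ℕ} {Ω : Set (E d)} (hΩ : IsOpen Ω)
    (hb : Bornology.IsBounded Ω) {θ : E d} (hθ : ‖θ‖ = 1) {x : E d} (hx : x ∈ Ω) :
    oppositePoint Ω θ (exitPoint Ω θ x) = exitPoint Ω (-θ) x := by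
  have h : ∃ x' ∈ Ω, exitPoint Ω θ x' = exitPoint Ω θ x := ⟨x, hx, rfl⟩
  rw [oppositePoint, dif_pos h]
  obtain ⟨h1, h2⟩ := h.choose_spec
  rcases le_total (exitTime Ω θ h.choose) (exitTime Ω θ x) with hle | hle
  · exact exitPoint_neg_eq hΩ hb hθ h1 h2.symm hle
  · exact (exitPoint_neg_eq hΩ hb hθ hx h2 hle).symm

/-- The chord through `x ∈ Ω` has length `ℓ_θ(x) = δ_θ(x) + δ_{-θ}(x)`. -/
theorem chordLength_exitPoint {d : ℕ} {Ω : Set (E d)} (hΩ : IsOpen Ω)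
    (hb : Bornology.IsBounded Ω) {θ : E d} (hθ : ‖θ‖ = 1) {x : E d} (hx : x ∈ Ω) :
    chordLength Ω θ (exitPoint Ω θ x) = exitTime Ω θ x + exitTime Ω (-θ) x := by
  have hθ' : ‖-θ‖ = 1 := by rwa [norm_neg]
  have h1 := (exitTime_spec hΩ hb hθ x).1
  have h2 := (exitTime_spec hΩ hb hθ' x).1
  rw [chordLength, oppositePoint_exitPoint hΩ hb hθ hx]
  have : exitPoint Ω (-θ) x - exitPoint Ω θ x
      = (exitTime Ω θ x + exitTime Ω (-θ) x) • -θ := by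
    simp only [exitPoint]; module
  rw [this, norm_smul, hθ', mul_one, Real.norm_of_nonneg (by linarith)]

/-- The directional measure `μ_θ`, `μ_θ(A) = ∫_Ω χ_A(Φ_θ(x)) dx`, as a measure on `ℝ^d`
(carried by `∂Ω`). -/
def dirMeasure {d : ℕ} (Ω : Set (E d)) (θ : E d) : Measure (E d) :=
  (volume.restrict Ω).map (exitPoint Ω θ)

theorem aemeasurable_exitPoint {d : ℕ} {Ω : Set (E d)} (hΩ : IsOpen Ω)
    (hb : Bornology.IsBounded Ω) {θ : E d} (hθ : ‖θ‖ = 1) :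
    AEMeasurable (exitPoint Ω θ) (volume.restrict Ω) := by
  have hm : Measurable (exitTime Ω θ) := by
    refine measurable_of_Ioi fun r => IsOpen.measurableSet ?_
    rcases lt_or_ge r 0 with hr | hr
    · convert isOpen_univ
      exact eq_univ_of_forall fun x => hr.trans_le (exitTime_spec hΩ hb hθ x).1
    · have : exitTime Ω θ ⁻¹' Ioi r = {x | ∀ t ∈ Icc 0 r, x + t • θ ∈ Ω} := by
        ext x
        obtain ⟨h0, h1, h2⟩ := exitTime_spec hΩ hb hθ x
        refine ⟨fun h t ht => h1 t ⟨ht.1, ht.2.trans_lt h⟩, fun h => ?_⟩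
        by_contra hc
        exact h2 (h _ ⟨h0, not_lt.1 hc⟩)
      rw [this, isOpen_iff_mem_nhds]
      intro x hx
      refine isCompact_Icc.eventually_forall_of_forall_eventually fun t ht => ?_
      have hc : Continuous fun p : E d × ℝ => p.1 + p.2 • θ := by fun_prop
      exact hc.continuousAt.eventually (hΩ.mem_nhds (hx t ht))
  have : Measurable (exitPoint Ω θ) := measurable_id.add (hm.smul_const θ)
  exact this.aemeasurable

/-- `μ_θ(A)` is the Lebesgue measure of the set of the `x ∈ Ω` such that `Φ_θ(x) ∈ A`. -/
theorem dirMeasure_apply {d : ℕ} {Ω : Set (E d)} (hΩ : IsOpen Ω)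
    (hb : Bornology.IsBounded Ω) {θ : E d} (hθ : ‖θ‖ = 1) {A : Set (E d)} (hA : MeasurableSet A) :
    dirMeasure Ω θ A = volume {x ∈ Ω | exitPoint Ω θ x ∈ A} := by
  rw [dirMeasure, Measure.map_apply_of_aemeasurable (aemeasurable_exitPoint hΩ hb hθ) hA,
    Measure.restrict_apply' hΩ.measurableSet, inter_comm]
  rfl

/-! ### Directional traces -/

/-- The orthogonal projection on the hyperplane orthogonal to the unit vector `θ`. -/
def proj {d : ℕ} (θ x : E d) : E d := x - ⟪x, θ⟫ • θ

/-- The `(d-1)`-dimensional Lebesgue measure of the hyperplane orthogonal to `θ`, as a measure on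
`ℝ^d`. -/
def hyperplaneMeasure {d : ℕ} (θ : E d) : Measure (E d) :=
  ((stdOrthonormalBasis ℝ (ℝ ∙ θ)ᗮ).toBasis.addHaar).map Subtype.val

/-- `ω_θ(y) = {s : sθ + y ∈ Ω}`. -/
def slice {d : ℕ} (Ω : Set (E d)) (θ y : E d) : Set ℝ := {s | s • θ + y ∈ Ω}

/-- `]α, β[` is one of the maximal bounded open intervals of the open set `S ⊆ ℝ`. -/
def IsComponentInterval (S : Set ℝ) (α β : ℝ) : Prop :=
  α < β ∧ Ioo α β ⊆ S ∧ α ∉ S ∧ β ∉ S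

/-- `f` is (a representative of) an element of `H¹(S)`, for an open set `S ⊆ ℝ`. -/
def MemH1 (S : Set ℝ) (f : ℝ → ℝ) : Prop :=
  MemLp f 2 (volume.restrict S) ∧ ∃ w : ℝ → ℝ, MemLp w 2 (volume.restrict S) ∧
    ∀ φ : ℝ → ℝ, IsTestFunction S φ →
      ∫ s in S, f s * deriv φ s = -∫ s in S, w s * φ s

/-- The directional trace `γ_θ u`: the set of all directional traces `g` of `u` in the
direction `θ`. In the last line, `h` is the representative of `s ↦ u(sθ + y)` that is continuous
on `]α, β]`. Only the values of `g` on `∂Ω` matter. -/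
def dirTrace {d : ℕ} (Ω : Set (E d)) (θ : E d) (u : L2 Ω) : Set (E d → ℝ) :=
  {g | ∃ f : E d → ℝ, f =ᵐ[volume.restrict Ω] u ∧ ∃ A ⊆ proj θ '' Ω,
    hyperplaneMeasure θ (proj θ '' Ω \ A) = 0 ∧
    ∀ y ∈ A, MemH1 (slice Ω θ y) (fun s => f (s • θ + y)) ∧
      ∀ α β : ℝ, IsComponentInterval (slice Ω θ y) α β →
        ∃ h : ℝ → ℝ, h =ᵐ[volume.restrict (Ioo α β)] (fun s => f (s • θ + y)) ∧
          ContinuousOn h (Ioc α β) ∧ g (β • θ + y) = h β}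

end DirectionalTrace

end

/-! Everything happens on chords. After extension by zero, let `f` and `w` represent `u` and its
weak derivative. For almost every `x`, the function `s ↦ f (x + s • θ)` is almost everywhere equal,
on the chord through `x`, to the primitive of `s ↦ w (x + s • θ)` with value `f x` at `s = 0`
(`ae_isChordPrimitiveAt`). This comes from testing the weak derivative against `x ↦ ∫ t in 0..s, φ
(x - t • θ)`, whose derivative along `θ` is `φ x - φ (x - s • θ)`. The directional traces are then
the values of these primitives at the two ends of the chord, and they exist because such primitives
are continuous up to the ends.

For two such functions, Leibniz' formula for absolutely continuous functions turns the difference of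
the products of traces into the integral of `u ∂v + v ∂u` over the chord. Division by the chord
length gives the mean value over the chord (`ae_dirTrace_eq_chordAvg`). Averaging along chords
preserves the integral over `Ω` (`integral_chordAvg`, a use of Fubini), and the directional measure
is the image of Lebesgue measure under `x ↦ exitPoint Ω θ x`, so the formula is a change of
variables.

The delicate point is measurability of the boundary integrand for the image measure, since traces
are only constrained on almost every line: it is a limit of functions evaluated slightly inside the
chords (`aestronglyMeasurable_dirMeasure`). -/

noncomputable section

namespace DirectionalTrace

/-! ### Chords and averages along chords -/

section Chord

variable {V : Type*} [NormedAddCommGroup V] [NormedSpace ℝ V] {Ω : Set V} {θ x : V} {r s : ℝ}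

/-- The set of the `s` such that the segment between `x` and `x + s • θ` is contained in `Ω`. -/
def chordSet (Ω : Set V) (θ x : V) : Set ℝ := {s | ∀ t ∈ uIcc 0 s, x + t • θ ∈ Ω}

theorem zero_mem_chordSet (hx : x ∈ Ω) : (0 : ℝ) ∈ chordSet Ω θ x := by
  intro t ht
  rw [uIcc_self, mem_singleton_iff] at ht
  simpa [ht] using hx

theorem add_smul_mem_of_mem_chordSet (hs : s ∈ chordSet Ω θ x) : x + s • θ ∈ Ω :=
  hs s right_mem_uIcc

theorem mem_of_mem_chordSet (hs : s ∈ chordSet Ω θ x) : x ∈ Ω := by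
  simpa using hs 0 left_mem_uIcc

/-- Rescaling replaces the interval `uIcc 0 s`, which moves with `s`, by a fixed compact one;
compactness then gives openness jointly in `x` and `s`. -/
theorem mem_chordSet_iff_forall_Icc :
    s ∈ chordSet Ω θ x ↔ ∀ t ∈ Icc (0 : ℝ) 1, x + (t * s) • θ ∈ Ω := by
  refine ⟨fun h t ht => h _ ?_, fun h t ht => ?_⟩
  · rw [mem_uIcc]
    rcases le_total 0 s with hs | hs
    · exact Or.inl ⟨mul_nonneg ht.1 hs, mul_le_of_le_one_left hs ht.2⟩
    · exact Or.inr ⟨by nlinarith [ht.2], mul_nonpos_of_nonneg_of_nonpos ht.1 hs⟩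
  · rcases eq_or_ne s 0 with rfl | hs
    · rw [uIcc_self, mem_singleton_iff] at ht
      simpa [ht] using h 0 (by simp)
    · have := h (t / s) ?_
      · rwa [div_mul_cancel₀ _ hs] at this
      · rw [mem_uIcc] at ht
        rcases ht with ht | ht
        · exact ⟨div_nonneg ht.1 (ht.1.trans ht.2), div_le_one_of_le₀ ht.2 (ht.1.trans ht.2)⟩
        · exact ⟨div_nonneg_of_nonpos ht.2 (ht.1.trans ht.2),
            div_le_one_of_ge ht.1 (ht.1.trans ht.2)⟩

theorem isOpen_setOf_mem_chordSet (hΩ : IsOpen Ω) (θ : V) :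
    IsOpen {p : V × ℝ | p.2 ∈ chordSet Ω θ p.1} := by
  simp only [mem_chordSet_iff_forall_Icc]
  rw [isOpen_iff_mem_nhds]
  intro p hp
  refine isCompact_Icc.eventually_forall_of_forall_eventually fun t ht => ?_
  have hc : Continuous fun q : (V × ℝ) × ℝ => q.1.1 + (q.2 * q.1.2) • θ := by fun_prop
  exact hc.continuousAt.eventually (hΩ.mem_nhds (hp t ht))

theorem isOpen_chordSet (hΩ : IsOpen Ω) (θ x : V) : IsOpen (chordSet Ω θ x) :=
  (isOpen_setOf_mem_chordSet hΩ θ).preimage (f := fun s : ℝ => (x, s)) (by fun_prop)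

theorem isOpen_setOf_mem_chordSet_left (hΩ : IsOpen Ω) (θ : V) (s : ℝ) :
    IsOpen {x | s ∈ chordSet Ω θ x} :=
  (isOpen_setOf_mem_chordSet hΩ θ).preimage (f := fun x : V => (x, s)) (by fun_prop)

theorem add_mem_chordSet (hs : s ∈ chordSet Ω θ x) (hr : r ∈ chordSet Ω θ (x + s • θ)) :
    s + r ∈ chordSet Ω θ x := by
  intro t ht
  rcases uIcc_subset_uIcc_union_uIcc (b := s) ht with h | h
  · exact hs t h
  · have := hr (t - s) (by rw [mem_uIcc] at h ⊢; rcases h with h | h <;> [left; right] <;>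
      constructor <;> linarith [h.1, h.2])
    rwa [add_assoc, ← add_smul, add_sub_cancel] at this

theorem neg_mem_chordSet (hs : s ∈ chordSet Ω θ x) : -s ∈ chordSet Ω θ (x + s • θ) := by
  intro t ht
  rw [add_assoc, ← add_smul]
  refine hs _ ?_
  rw [mem_uIcc] at ht ⊢
  rcases ht with h | h <;> [right; left] <;> constructor <;> linarith [h.1, h.2]

theorem mem_chordSet_add_smul (hs : s ∈ chordSet Ω θ x) :
    r ∈ chordSet Ω θ (x + s • θ) ↔ s + r ∈ chordSet Ω θ x := by
  refine ⟨add_mem_chordSet hs, fun h => ?_⟩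
  have := add_mem_chordSet (neg_mem_chordSet hs) (r := s + r) (by simpa using h)
  simpa using this

theorem neg_mem_chordSet_add_smul_iff : -s ∈ chordSet Ω θ (x + s • θ) ↔ s ∈ chordSet Ω θ x :=
  ⟨fun h => by simpa using neg_mem_chordSet h, neg_mem_chordSet⟩

theorem chordSet_add_smul (hs : s ∈ chordSet Ω θ x) :
    chordSet Ω θ (x + s • θ) = (fun r => s + r) ⁻¹' chordSet Ω θ x :=
  Set.ext fun _ => mem_chordSet_add_smul hs

theorem chordSet_eq_empty (hx : x ∉ Ω) : chordSet Ω θ x = ∅ :=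
  eq_empty_of_forall_notMem fun _ h => hx (mem_of_mem_chordSet h)

theorem volume_chordSet_ne_zero (hΩ : IsOpen Ω) (hx : x ∈ Ω) : volume (chordSet Ω θ x) ≠ 0 :=
  ((isOpen_chordSet hΩ θ x).measure_pos _ ⟨0, zero_mem_chordSet hx⟩).ne'

theorem volume_chordSet_ne_top (hb : Bornology.IsBounded Ω) (hθ : θ ≠ 0) :
    volume (chordSet Ω θ x) ≠ ⊤ := by
  have : Bornology.IsBounded (chordSet Ω θ x) := by
    obtain ⟨R, hR⟩ := hb.exists_norm_le
    refine isBounded_iff_forall_norm_le.2 ⟨(R + ‖x‖) / ‖θ‖, fun s hs => ?_⟩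
    rw [le_div_iff₀ (norm_pos_iff.2 hθ), ← norm_smul]
    have h1 := hR _ (add_smul_mem_of_mem_chordSet hs)
    have h2 := norm_sub_le (x + s • θ) x
    rw [add_sub_cancel_left] at h2
    linarith
  exact this.measure_lt_top.ne

theorem volume_chordSet_add_smul (hs : s ∈ chordSet Ω θ x) :
    volume (chordSet Ω θ (x + s • θ)) = volume (chordSet Ω θ x) := by
  rw [chordSet_add_smul hs, measure_preimage_add]

/-- The mean value of `G` on the chord through `x` in the direction `θ`. -/
def chordAvg (Ω : Set V) (θ : V) (G : V → ℝ) (x : V) : ℝ :=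
  (volume.real (chordSet Ω θ x))⁻¹ * ∫ s in chordSet Ω θ x, G (x + s • θ)

/-- Moving the base point only translates the parameter of the chord, so the average belongs to the
chord and not to the point. -/
theorem chordAvg_add_smul (hΩ : IsOpen Ω) (G : V → ℝ) (hs : s ∈ chordSet Ω θ x) :
    chordAvg Ω θ G (x + s • θ) = chordAvg Ω θ G x := by
  have hm := fun y => (isOpen_chordSet hΩ θ y).measurableSet
  rw [chordAvg, chordAvg, measureReal_def, volume_chordSet_add_smul hs, ← measureReal_def]
  congr 1
  rw [← integral_indicator (hm _), ← integral_indicator (hm _),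
    ← integral_add_left_eq_self ((chordSet Ω θ x).indicator fun r => G (x + r • θ)) s]
  congr 1 with r
  rw [chordSet_add_smul hs]
  simp only [indicator, add_smul, add_assoc]
  rfl

/-! ### Fubini along chords -/

variable [MeasurableSpace V] [BorelSpace V] [FiniteDimensional ℝ V]
  (μ : Measure V) [μ.IsAddHaarMeasure]

/-- For fixed `s` this is a translation of `V`, followed by a reflection of `s`. The map is an
involution that exchanges the base point and the running point of a chord. -/
theorem measurePreserving_shear (θ : V) :
    MeasurePreserving (fun p : V × ℝ => (p.1 + p.2 • θ, -p.2)) (μ.prod volume)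
      (μ.prod volume) := by
  have h : MeasurePreserving (fun p : ℝ × V => (-p.1, p.2 + p.1 • θ))
      ((volume : Measure ℝ).prod μ) ((volume : Measure ℝ).prod μ) := by
    refine (Measure.measurePreserving_neg (volume : Measure ℝ)).skew_product
      (g := fun s x => x + s • θ) ?_ ?_
    · exact Continuous.measurable (by fun_prop)
    · exact Filter.Eventually.of_forall fun s => (measurePreserving_add_right μ (s • θ)).map_eq
  exact Measure.measurePreserving_swap.comp (h.comp Measure.measurePreserving_swap)

theorem quasiMeasurePreserving_add_smul (θ : V) :
    Measure.QuasiMeasurePreserving (fun p : V × ℝ => p.1 + p.2 • θ) (μ.prod volume) μ :=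
  Measure.quasiMeasurePreserving_fst.comp (measurePreserving_shear μ θ).quasiMeasurePreserving

theorem ae_ae_add_smul {μ : Measure V} [μ.IsAddHaarMeasure] {p : V → Prop} (h : ∀ᵐ x ∂μ, p x)
    (θ : V) : ∀ᵐ x ∂μ, ∀ᵐ s : ℝ, p (x + s • θ) :=
  Measure.ae_ae_of_ae_prod ((quasiMeasurePreserving_add_smul μ θ).ae h)

/-- Spread the mass `G x` uniformly over the chord through `x`: this is `Ψ`. Integrating `Ψ` in `s`
returns `G`. After the shear, since all points of a chord see the same chord length, integrating in
`s` gives the average instead. -/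
theorem integral_chordAvg {μ : Measure V} [μ.IsAddHaarMeasure] (hΩ : IsOpen Ω)
    (hb : Bornology.IsBounded Ω) (hθ : θ ≠ 0)
    {G : V → ℝ} (hG : IntegrableOn G Ω μ) :
    IntegrableOn (chordAvg Ω θ G) Ω μ ∧ ∫ x in Ω, chordAvg Ω θ G x ∂μ = ∫ x in Ω, G x ∂μ := by
  set C : Set (V × ℝ) := {p | p.2 ∈ chordSet Ω θ p.1} with hC
  have hCm : MeasurableSet C := (isOpen_setOf_mem_chordSet hΩ θ).measurableSet
  have hLm : Measurable fun x => volume.real (chordSet Ω θ x) :=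
    (measurable_measure_prodMk_left hCm).ennreal_toReal
  have hLpos : ∀ x ∈ Ω, volume.real (chordSet Ω θ x) ≠ 0 := fun x hx =>
    (ENNReal.toReal_pos (volume_chordSet_ne_zero hΩ hx) (volume_chordSet_ne_top hb hθ)).ne'
  have hm := fun y => (isOpen_chordSet hΩ θ y).measurableSet
  set g := Ω.indicator G with hg
  have hgi : Integrable g μ := (integrable_indicator_iff hΩ.measurableSet).2 hG
  set Ψ : V × ℝ → ℝ := C.indicator fun p => (volume.real (chordSet Ω θ p.1))⁻¹ * g p.1 with hΨ
  have hΨm : AEStronglyMeasurable Ψ (μ.prod volume) := by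
    refine AEStronglyMeasurable.indicator ?_ hCm
    exact (hLm.inv.comp measurable_fst).aestronglyMeasurable.mul hgi.aestronglyMeasurable.comp_fst
  have hsec : ∀ x, (fun s => Ψ (x, s)) = (chordSet Ω θ x).indicator
      fun _ => (volume.real (chordSet Ω θ x))⁻¹ * g x := fun x => by
    ext s; simp [hΨ, indicator, hC]
  have hΨint : ∀ x, ∫ s, Ψ (x, s) = g x := by
    intro x
    rw [hsec, integral_indicator (hm x), setIntegral_const, smul_eq_mul]
    by_cases hx : x ∈ Ω
    · rw [mul_inv_cancel_left₀ (hLpos x hx)]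
    · simp [hg, hx]
  have hΨn : ∀ x, ∫ s, ‖Ψ (x, s)‖ = ‖g x‖ := by
    intro x
    have : (fun s => ‖Ψ (x, s)‖) = (chordSet Ω θ x).indicator
        fun _ => ‖(volume.real (chordSet Ω θ x))⁻¹ * g x‖ := by
      ext s
      rw [← norm_indicator_eq_indicator_norm, ← hsec]
    rw [this, integral_indicator (hm x), setIntegral_const, smul_eq_mul, norm_mul, norm_inv,
      Real.norm_of_nonneg measureReal_nonneg]
    by_cases hx : x ∈ Ω
    · rw [mul_inv_cancel_left₀ (hLpos x hx)]
    · simp [hg, hx]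
  have hΨi : Integrable Ψ (μ.prod volume) := by
    rw [integrable_prod_iff hΨm]
    refine ⟨Filter.Eventually.of_forall fun x => ?_, ?_⟩
    · rw [hsec, integrable_indicator_iff (hm x)]
      exact integrableOn_const (volume_chordSet_ne_top hb hθ)
    · simpa only [hΨn] using hgi.norm
  have hT := measurePreserving_shear μ θ
  have hTΨ : ∀ x s, Ψ (x + s • θ, -s) = (chordSet Ω θ x).indicator
      (fun s => (volume.real (chordSet Ω θ x))⁻¹ * G (x + s • θ)) s := by
    intro x s
    by_cases h : s ∈ chordSet Ω θ x
    · have h' : (x + s • θ, -s) ∈ C := neg_mem_chordSet h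
      rw [hΨ, indicator_of_mem h', indicator_of_mem h, measureReal_def,
        volume_chordSet_add_smul h, hg, indicator_of_mem (add_smul_mem_of_mem_chordSet h),
        ← measureReal_def]
    · have h' : (x + s • θ, -s) ∉ C := fun h' => h (neg_mem_chordSet_add_smul_iff.1 h')
      rw [hΨ, indicator_of_notMem h', indicator_of_notMem h]
  have hΦi : Integrable (fun p : V × ℝ => Ψ (p.1 + p.2 • θ, -p.2)) (μ.prod volume) :=
    hT.integrable_comp_of_integrable hΨi
  have havg : ∀ x, ∫ s, Ψ (x + s • θ, -s) = chordAvg Ω θ G x := by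
    intro x
    simp only [hTΨ]
    rw [integral_indicator (hm x), integral_const_mul, chordAvg]
  have h1 : Integrable (chordAvg Ω θ G) μ := by
    simpa only [havg] using hΦi.integral_prod_left
  refine ⟨h1.integrableOn, ?_⟩
  rw [setIntegral_eq_integral_of_forall_compl_eq_zero, ← integral_indicator hΩ.measurableSet]
  · have e1 : ∫ p, Ψ (p.1 + p.2 • θ, -p.2) ∂(μ.prod volume) = ∫ p, Ψ p ∂(μ.prod volume) := by
      have hemb : AEStronglyMeasurable Ψ
          (Measure.map (fun p : V × ℝ => (p.1 + p.2 • θ, -p.2)) (μ.prod volume)) := by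
        rw [hT.map_eq]; exact hΨm
      rw [← integral_map hT.measurable.aemeasurable hemb, hT.map_eq]
    rw [integral_prod _ hΦi, integral_prod _ hΨi] at e1
    simpa only [havg, hΨint] using e1
  · intro x hx
    simp [chordAvg, chordSet_eq_empty hx]

end Chord

/-! ### Primitives of locally integrable functions -/

theorem integral_mul_add_mul_of_primitives {p q : ℝ → ℝ} {a b : ℝ} {c e : ℝ} {r₀ : ℝ}
    (hp : ∀ s t, IntervalIntegrable p volume s t) (hq : ∀ s t, IntervalIntegrable q volume s t) :
    ∫ r in a..b, ((c + ∫ t in r₀..r, p t) * q r + (e + ∫ t in r₀..r, q t) * p r) =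
      (c + ∫ t in r₀..b, p t) * (e + ∫ t in r₀..b, q t) -
        (c + ∫ t in r₀..a, p t) * (e + ∫ t in r₀..a, q t) := by
  have key : ∀ (p : ℝ → ℝ) (c : ℝ), (∀ s t, IntervalIntegrable p volume s t) →
      AbsolutelyContinuousOnInterval (fun r => c + ∫ t in r₀..r, p t) a b := by
    intro p c hp
    -- The base point `r₀` may lie outside `[a, b]`; the primitive is re-based at `a`, at the cost
    -- of a constant.
    have h1 := (hp a b).absolutelyContinuousOnInterval_intervalIntegral (c := a) (by simp)
    have h2 : AbsolutelyContinuousOnInterval (fun _ : ℝ => c + ∫ t in r₀..a, p t) a b :=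
      (LipschitzWith.const _ : LipschitzWith 0 _).lipschitzOnWith.absolutelyContinuousOnInterval
    convert! h2.add h1 using 1
    ext r
    simp [add_assoc, intervalIntegral.integral_add_adjacent_intervals (hp _ _) (hp _ _)]
  have kd : ∀ (p : ℝ → ℝ) (c : ℝ), (∀ s t, IntervalIntegrable p volume s t) →
      ∀ᵐ r, r ∈ uIcc a b → deriv (fun r => c + ∫ t in r₀..r, p t) r = p r := by
    intro p c hp
    filter_upwards [(hp a b).ae_hasDerivAt_integral] with r hr hrab
    have h1 := (hr hrab a (by simp)).const_add (c + ∫ t in r₀..a, p t)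
    have : (fun r => c + ∫ t in r₀..r, p t) =
        fun r => (c + ∫ t in r₀..a, p t) + ∫ t in a..r, p t := by
      ext r
      simp [add_assoc, intervalIntegral.integral_add_adjacent_intervals (hp _ _) (hp _ _)]
    rw [this]
    exact h1.deriv
  rw [← (key p c hp).integral_deriv_mul_eq_sub (key q e hq)]
  refine intervalIntegral.integral_congr_ae ?_
  filter_upwards [kd p c hp, kd q e hq] with r h1 h2 hr
  rw [h1 (uIoc_subset_uIcc hr), h2 (uIoc_subset_uIcc hr)]
  ring

/-! ### Increments of functions with a weak directional derivative -/

section Increment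

variable {V : Type*} [NormedAddCommGroup V] [NormedSpace ℝ V] {Ω : Set V} {θ : V}

theorem contDiff_integral_sub_smul {φ : V → ℝ} (hφ : ContDiff ℝ ∞ φ) (hc : HasCompactSupport φ)
    (hθ : θ ≠ 0) (s : ℝ) : ContDiff ℝ ∞ fun x => ∫ t in 0..s, φ (x - t • θ) := by
  rw [contDiff_iff_contDiffAt]
  intro x₀
  -- write the integral as a convolution on `ℝ` with parameter `x`
  have key : ∀ a b : ℝ, a ≤ b → ContDiffAt ℝ ∞ (fun x => ∫ t in a..b, φ (x - t • θ)) x₀ := by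
    intro a b hab
    obtain ⟨R, hR⟩ := hc.isCompact.isBounded.exists_norm_le
    -- If `x` is within `1` of `x₀` and `x + r • θ` lies in the support of `φ`, then `|r| ‖θ‖ ≤ R +
    -- ‖x‖ < R + ‖x₀‖ + 1`.
    have hk : IsCompact (Metric.closedBall (0 : ℝ) ((R + ‖x₀‖ + 1) / ‖θ‖)) :=
      isCompact_closedBall _ _
    have hf : LocallyIntegrable ((Ioc a b).indicator fun _ => (1 : ℝ)) volume :=
      ((integrable_indicator_iff measurableSet_Ioc).2
        (integrableOn_const measure_Ioc_lt_top.ne)).locallyIntegrable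
    have h := contDiffOn_convolution_right_with_param_comp (𝕜 := ℝ) (n := ⊤)
      (ContinuousLinearMap.mul ℝ ℝ) (s := Metric.ball x₀ 1) (v := fun _ : V => (0 : ℝ))
      contDiffOn_const (g := fun x r => φ (x + r • θ)) Metric.isOpen_ball hk
      (fun x r hx hr => by
        refine image_eq_zero_of_notMem_tsupport fun hm => hr ?_
        have h1 := hR _ hm
        have h2 := norm_sub_le (x + r • θ) x
        rw [add_sub_cancel_left, norm_smul] at h2
        have h3 : ‖x‖ < ‖x₀‖ + 1 := by
          have := norm_sub_norm_le x x₀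
          rw [Metric.mem_ball, dist_eq_norm] at hx
          linarith
        rw [mem_closedBall_zero_iff, le_div_iff₀ (norm_pos_iff.2 hθ)]
        linarith) hf
      (hφ.comp (f := fun p : V × ℝ => p.1 + p.2 • θ) (by fun_prop)).contDiffOn
    refine (h.contDiffAt (Metric.ball_mem_nhds x₀ one_pos)).congr_of_eventuallyEq
      (Filter.Eventually.of_forall fun x => ?_)
    simp only [convolution, ContinuousLinearMap.mul_apply']
    rw [intervalIntegral.integral_of_le hab, ← integral_indicator measurableSet_Ioc]
    congr 1 with t
    by_cases ht : t ∈ Ioc a b <;> simp [ht, sub_eq_add_neg]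
  rcases le_total 0 s with hs | hs
  · exact key 0 s hs
  · simp only [intervalIntegral.integral_symm s 0]
    exact (key s 0 hs).neg

/-- Along the line `x + r • θ` the integral becomes that of `q` from `r - s` to `r`; only its two
ends move with `r`. -/
theorem fderiv_integral_sub_smul {φ : V → ℝ} (hφ : ContDiff ℝ ∞ φ) (hc : HasCompactSupport φ)
    (hθ : θ ≠ 0) (s : ℝ) (x : V) :
    fderiv ℝ (fun x => ∫ t in 0..s, φ (x - t • θ)) x θ = φ x - φ (x - s • θ) := by
  have hd := ((contDiff_integral_sub_smul hφ hc hθ s).differentiable (by simp)) x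
  set q : ℝ → ℝ := fun t => φ (x + t • θ) with hq
  have hqc : Continuous q := by have := hφ.continuous; fun_prop
  have h1 : HasDerivAt (fun r : ℝ => x + r • θ) θ 0 := by
    simpa using ((hasDerivAt_id (0 : ℝ)).smul_const θ).const_add x
  have h2 := HasFDerivAt.comp_hasDerivAt_of_eq (0 : ℝ) hd.hasFDerivAt h1 (by simp)
  have h3 : (fun r : ℝ => ∫ t in 0..s, φ (x + r • θ - t • θ)) =
      fun r => (∫ t in 0..r, q t) - ∫ t in 0..(r - s), q t := by
    ext r
    have : (fun t : ℝ => φ (x + r • θ - t • θ)) = fun t => q (r - t) := by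
      ext t; simp only [hq, sub_smul, add_sub]
    rw [this, intervalIntegral.integral_comp_sub_left q, sub_zero,
      intervalIntegral.integral_interval_sub_left] <;> exact hqc.intervalIntegrable _ _
  have h4 : HasDerivAt (fun r => (∫ t in 0..r, q t) - ∫ t in 0..(r - s), q t)
      (q 0 - q (0 - s)) 0 := by
    refine (hqc.integral_hasStrictDerivAt 0 0).hasDerivAt.sub ?_
    exact (hqc.integral_hasStrictDerivAt 0 (0 - s)).hasDerivAt.comp_sub_const 0 s
  have h5 := h2.unique (h3 ▸ h4)
  rw [h5]
  simp [hq, sub_eq_add_neg]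

/-- The support is swept out by moving the support of `φ` along segments that stay in `Ω`. -/
theorem isTestFunction_integral_sub_smul {φ : V → ℝ} {s : ℝ}
    (hφ : IsTestFunction {x | s ∈ chordSet Ω θ x} φ) (hθ : θ ≠ 0) :
    IsTestFunction Ω fun x => ∫ t in 0..s, φ (x - t • θ) := by
  have hK : IsCompact ((fun p : V × ℝ => p.1 + p.2 • θ) '' (tsupport φ ×ˢ uIcc 0 s)) :=
    (hφ.2.1.isCompact.prod isCompact_uIcc).image (by fun_prop)
  have hsub : Function.support (fun x => ∫ t in 0..s, φ (x - t • θ)) ⊆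
      (fun p : V × ℝ => p.1 + p.2 • θ) '' (tsupport φ ×ˢ uIcc 0 s) := by
    intro x hx
    by_contra hc
    refine hx (intervalIntegral.integral_zero_ae (Filter.Eventually.of_forall fun t ht => ?_))
    refine image_eq_zero_of_notMem_tsupport fun hm => hc ?_
    exact ⟨(x - t • θ, t), ⟨hm, uIoc_subset_uIcc ht⟩, by simp⟩
  have hts := closure_minimal hsub hK.isClosed
  refine ⟨contDiff_integral_sub_smul hφ.1 hφ.2.1 hθ s, hK.of_isClosed_subset isClosed_closure hts,
    hts.trans ?_⟩
  rintro _ ⟨⟨x, t⟩, ⟨hx, ht⟩, rfl⟩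
  exact hφ.2.2 hx t ht

variable [MeasurableSpace V] [BorelSpace V] [FiniteDimensional ℝ V]
  {μ : Measure V} [μ.IsAddHaarMeasure] {f w : V → ℝ}

theorem isFiniteMeasure_restrict_uIoc (a b : ℝ) :
    IsFiniteMeasure ((volume : Measure ℝ).restrict (uIoc a b)) := by
  refine ⟨?_⟩
  rcases le_total a b with h | h
  · simp [uIoc_of_le h]
  · simp [uIoc_of_ge h]

theorem integrable_comp_add_smul (hw : Integrable w μ) (θ : V) (a b : ℝ) :
    Integrable (fun p : V × ℝ => w (p.1 + p.2 • θ)) (μ.prod (volume.restrict (uIoc a b))) := by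
  -- The window is reflected because the shear changes the sign of `s`.
  have hS : MeasurableSet (univ ×ˢ (Neg.neg ⁻¹' uIoc a b) : Set (V × ℝ)) :=
    MeasurableSet.univ.prod (measurableSet_uIoc.preimage measurable_neg)
  have hr : μ.prod (volume.restrict (uIoc a b)) =
      (μ.prod volume).restrict (univ ×ˢ uIoc a b) := by
    rw [← Measure.prod_restrict, Measure.restrict_univ]
  have : IsFiniteMeasure ((volume : Measure ℝ).restrict (Neg.neg ⁻¹' uIoc a b)) := by
    refine ⟨?_⟩
    have := (isFiniteMeasure_restrict_uIoc a b).measure_univ_lt_top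
    rw [Measure.restrict_apply_univ] at this ⊢
    rwa [(Measure.measurePreserving_neg volume).measure_preimage
      measurableSet_uIoc.nullMeasurableSet]
  have h1 : Integrable (fun p : V × ℝ => w p.1)
      ((μ.prod volume).restrict (univ ×ˢ (Neg.neg ⁻¹' uIoc a b))) := by
    rw [← Measure.prod_restrict, Measure.restrict_univ]
    exact hw.comp_fst _
  rw [hr]
  have h2 := (measurePreserving_shear μ θ).restrict_preimage hS
  have h3 := h2.integrable_comp_of_integrable h1
  convert! h3 using 2
  ext p
  simp

theorem ae_intervalIntegrable_add_smul (hw : Integrable w μ) (θ : V) :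
    ∀ᵐ x ∂μ, ∀ a b, IntervalIntegrable (fun t => w (x + t • θ)) volume a b := by
  have h : ∀ᵐ x ∂μ, ∀ n : ℕ, IntervalIntegrable (fun t => w (x + t • θ)) volume (-n) n := by
    rw [ae_all_iff]
    intro n
    filter_upwards [(integrable_comp_add_smul hw θ (-n) n).prod_right_ae] with x hx
    rw [intervalIntegrable_iff]
    exact hx
  filter_upwards [h] with x hx a b
  -- Countably many windows `[-n, n]` suffice, so one null set of `x` serves all `a` and `b`.
  obtain ⟨n, hn⟩ := exists_nat_ge (max |a| |b|)
  have ha := abs_le.1 ((le_max_left _ _).trans hn)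
  have hb := abs_le.1 ((le_max_right _ _).trans hn)
  refine (hx n).mono_set (uIcc_subset_uIcc ?_ ?_) <;> rw [mem_uIcc]
  · exact Or.inl ha
  · exact Or.inl hb

/-- The increment of `f` along a segment contained in `Ω` is the integral of its weak directional
derivative. -/
theorem ae_add_smul_eq_add_integral (hΩ : IsOpen Ω) (hθ : θ ≠ 0) (hf : Integrable f μ)
    (hw : Integrable w μ)
    (h : ∀ φ, IsTestFunction Ω φ → ∫ x, f x * fderiv ℝ φ x θ ∂μ = -∫ x, w x * φ x ∂μ) (s : ℝ) :
    ∀ᵐ x ∂μ, s ∈ chordSet Ω θ x → f (x + s • θ) = f x + ∫ t in 0..s, w (x + t • θ) := by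
  have hshift : Integrable (fun x => f (x + s • θ)) μ := hf.comp_add_right _
  have hW : Integrable (fun x => ∫ t in 0..s, w (x + t • θ)) μ := by
    have := (integrable_comp_add_smul hw θ 0 s).integral_prod_left
    simp only [intervalIntegral.intervalIntegral_eq_integral_uIoc]
    exact this.smul (if 0 ≤ s then (1 : ℝ) else -1)
  have hi := (hshift.sub hf).sub hW
  have key := (isOpen_setOf_mem_chordSet_left hΩ θ s).ae_eq_zero_of_integral_contDiff_smul_eq_zero
    (hi.locallyIntegrable.locallyIntegrableOn _) ?_
  · filter_upwards [key] with x hx hs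
    have := hx hs
    simp only [Pi.sub_apply] at this
    linarith
  intro φ h1 h2 h3
  -- The translations in this identity are moved from `φ` onto `f` and `w` by invariance of `μ`
  -- (`e1`, `e2`).
  have ht := h _ (isTestFunction_integral_sub_smul ⟨h1, h2, h3⟩ hθ)
  simp only [fderiv_integral_sub_smul h1 h2 hθ] at ht
  obtain ⟨M, hM⟩ := h1.continuous.bounded_above_of_compact_support h2
  have hmulφ : ∀ (y : V) {g : V → ℝ}, Integrable g μ → Integrable (fun x => g x * φ (x - y)) μ :=
    fun y g hg => hg.mul_bdd (c := M) (h1.continuous.comp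
      (continuous_id.sub continuous_const)).aestronglyMeasurable
      (Filter.Eventually.of_forall fun x => hM _)
  have hmulφ' : ∀ {g : V → ℝ}, Integrable g μ → Integrable (fun x => g x * φ x) μ :=
    fun hg => by simpa using hmulφ 0 hg
  have e1 : ∫ x, f x * φ (x - s • θ) ∂μ = ∫ x, f (x + s • θ) * φ x ∂μ := by
    rw [← integral_add_right_eq_self _ (s • θ)]
    simp
  have e2 : ∫ x, w x * (∫ t in 0..s, φ (x - t • θ)) ∂μ =
      ∫ x, (∫ t in 0..s, w (x + t • θ)) * φ x ∂μ := by
    have := isFiniteMeasure_restrict_uIoc 0 s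
    have i1 : Integrable (fun p : ℝ × V => w p.2 * φ (p.2 - p.1 • θ))
        ((volume.restrict (uIoc 0 s)).prod μ) := by
      refine (hw.comp_snd _).mul_bdd (c := M) ?_ (Filter.Eventually.of_forall fun x => hM _)
      exact Continuous.aestronglyMeasurable (by have := h1.continuous; fun_prop)
    have i2 : Integrable (fun p : ℝ × V => w (p.2 + p.1 • θ) * φ p.2)
        ((volume.restrict (uIoc 0 s)).prod μ) := by
      refine ((integrable_comp_add_smul hw θ 0 s).swap).mul_bdd (c := M) ?_
        (Filter.Eventually.of_forall fun x => hM _)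
      exact Continuous.aestronglyMeasurable (by have := h1.continuous; fun_prop)
    simp only [← intervalIntegral.integral_const_mul, ← intervalIntegral.integral_mul_const]
    rw [← intervalIntegral_integral_swap (f := fun t x => w x * φ (x - t • θ)) i1,
      ← intervalIntegral_integral_swap (f := fun t x => w (x + t • θ) * φ x) i2]
    congr 1 with t
    rw [← integral_add_right_eq_self _ (t • θ)]
    simp
  simp only [mul_sub] at ht
  rw [integral_sub (hmulφ' hf) (hmulφ _ hf), e1, e2] at ht
  have : ∀ x, φ x • ((fun x => f (x + s • θ)) - f - fun x => ∫ t in 0..s, w (x + t • θ)) x =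
      f (x + s • θ) * φ x - f x * φ x - (∫ t in 0..s, w (x + t • θ)) * φ x := by
    intro x; simp only [Pi.sub_apply, smul_eq_mul]; ring
  simp only [this]
  rw [integral_sub (f := fun x => f (x + s • θ) * φ x - f x * φ x) ((hmulφ' hshift).sub (hmulφ' hf))
    (hmulφ' hW), integral_sub (hmulφ' hshift) (hmulφ' hf)]
  linarith

/-- `x` is a point such that, on the chord through `x`, `f` is almost everywhere equal to a
primitive of `w` that takes the value `f x` at `x`. -/
structure IsChordPrimitiveAt (Ω : Set V) (θ : V) (f w : V → ℝ) (x : V) : Prop where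
  intervalIntegrable : ∀ a b, IntervalIntegrable (fun t => w (x + t • θ)) volume a b
  ae_eq : ∀ᵐ s : ℝ, s ∈ chordSet Ω θ x → f (x + s • θ) = f x + ∫ t in 0..s, w (x + t • θ)

/-- The increment formula holds for each `s` off a null set of `x` depending on `s`. Fubini
exchanges the two quantifiers, which needs joint measurability of the relation. -/
theorem ae_isChordPrimitiveAt (hΩ : IsOpen Ω) (hθ : θ ≠ 0) (hf : Integrable f μ)
    (hfm : Measurable f) (hw : Integrable w μ) (hwm : StronglyMeasurable w)
    (h : ∀ φ, IsTestFunction Ω φ → ∫ x, f x * fderiv ℝ φ x θ ∂μ = -∫ x, w x * φ x ∂μ) :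
    ∀ᵐ x ∂μ, IsChordPrimitiveAt Ω θ f w x := by
  have hcont : Continuous fun p : V × ℝ => p.1 + p.2 • θ := by fun_prop
  have hIm : Measurable fun p : V × ℝ => ∫ t in 0..p.2, w (p.1 + t • θ) := by
    have hF : StronglyMeasurable fun q : (V × ℝ) × ℝ => w (q.1.1 + q.2 • θ) :=
      hwm.comp_measurable (Continuous.measurable (by fun_prop))
    have hA : MeasurableSet {q : (V × ℝ) × ℝ | 0 < q.2 ∧ q.2 ≤ q.1.2} :=
      (measurableSet_lt measurable_const measurable_snd).inter
        (measurableSet_le measurable_snd (measurable_snd.comp measurable_fst))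
    -- `hA` and `hB` carry the two signs of the oriented integral, which becomes a difference of
    -- integrals over all of `ℝ`.
    have hB : MeasurableSet {q : (V × ℝ) × ℝ | q.1.2 < q.2 ∧ q.2 ≤ 0} :=
      (measurableSet_lt (measurable_snd.comp measurable_fst) measurable_snd).inter
        (measurableSet_le measurable_snd measurable_const)
    have h1 := ((hF.indicator hA).integral_prod_right' (ν := (volume : Measure ℝ))).measurable
    have h2 := ((hF.indicator hB).integral_prod_right' (ν := (volume : Measure ℝ))).measurable
    convert h1.sub h2 using 2 with p
    rw [Pi.sub_apply, intervalIntegral, ← integral_indicator measurableSet_Ioc,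
      ← integral_indicator measurableSet_Ioc]
    rfl
  have hS : MeasurableSet {p : ℝ × V | p.1 ∈ chordSet Ω θ p.2 →
      f (p.2 + p.1 • θ) = f p.2 + ∫ t in 0..p.1, w (p.2 + t • θ)} := by
    refine MeasurableSet.imp ?_ ?_
    · exact (isOpen_setOf_mem_chordSet hΩ θ).measurableSet.preimage measurable_swap
    · exact (measurableSet_eq_fun (hfm.comp hcont.measurable)
        ((hfm.comp measurable_fst).add hIm)).preimage measurable_swap
  have h1 : ∀ᵐ s : ℝ, ∀ᵐ x ∂μ, s ∈ chordSet Ω θ x →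
      f (x + s • θ) = f x + ∫ t in 0..s, w (x + t • θ) :=
    Filter.Eventually.of_forall fun s => ae_add_smul_eq_add_integral hΩ hθ hf hw h s
  rw [Measure.ae_ae_comm hS] at h1
  filter_upwards [h1, ae_intervalIntegrable_add_smul hw θ] with x hx hi
  exact ⟨hi, hx⟩

end Increment

variable {d : ℕ} {Ω : Set (E d)} {θ : E d}

/-! ### Slicing in the direction of a unit vector -/

theorem inner_self_of_norm_eq_one (hθ : ‖θ‖ = 1) : ⟪θ, θ⟫ = 1 := by
  rw [real_inner_self_eq_norm_sq, hθ, one_pow]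

theorem inner_proj (hθ : ‖θ‖ = 1) (x : E d) : ⟪proj θ x, θ⟫ = 0 := by
  rw [proj, inner_sub_left, real_inner_smul_left, inner_self_of_norm_eq_one hθ, mul_one, sub_self]

theorem inner_smul_add_proj (θ x : E d) : ⟪x, θ⟫ • θ + proj θ x = x := by
  rw [proj, add_sub_cancel]

theorem inner_smul_add (hθ : ‖θ‖ = 1) {y : E d} (hy : ⟪y, θ⟫ = 0) (r : ℝ) :
    ⟪r • θ + y, θ⟫ = r := by
  rw [inner_add_left, real_inner_smul_left, inner_self_of_norm_eq_one hθ, hy, mul_one, add_zero]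

theorem proj_smul_add (hθ : ‖θ‖ = 1) {y : E d} (hy : ⟪y, θ⟫ = 0) (r : ℝ) :
    proj θ (r • θ + y) = y := by
  rw [proj, inner_smul_add hθ hy, add_sub_cancel_left]

theorem proj_add_smul (hθ : ‖θ‖ = 1) (x : E d) (s : ℝ) : proj θ (x + s • θ) = proj θ x := by
  rw [proj, proj, inner_add_left, real_inner_smul_left, inner_self_of_norm_eq_one hθ]
  module

/-- The decomposition of `ℝ^d` as the product of the hyperplane orthogonal to `θ` and of the line
directed by `θ`. -/
def sliceEquiv (θ : E d) (hθ : ‖θ‖ = 1) : ((ℝ ∙ θ)ᗮ × ℝ) ≃L[ℝ] E d :=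
  LinearEquiv.toContinuousLinearEquiv
    { toFun := fun p => p.2 • θ + p.1
      map_add' := fun p q => by simp only [Prod.fst_add, Prod.snd_add, Submodule.coe_add]; module
      map_smul' := fun c p => by
        simp only [Prod.smul_fst, Prod.smul_snd, Submodule.coe_smul, smul_eq_mul,
          RingHom.id_apply]
        module
      invFun := fun x => (⟨proj θ x, by
        rw [Submodule.mem_orthogonal_singleton_iff_inner_left]; exact inner_proj hθ x⟩, ⟪x, θ⟫)
      left_inv := fun p => by
        have hp : ⟪(p.1 : E d), θ⟫ = 0 := Submodule.mem_orthogonal_singleton_iff_inner_left.1 p.1.2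
        ext1
        · exact Subtype.ext (proj_smul_add hθ hp _)
        · exact inner_smul_add hθ hp _
      right_inv := fun x => inner_smul_add_proj θ x }

theorem ae_hyperplaneMeasure_iff {p : E d → Prop} :
    (∀ᵐ y ∂(hyperplaneMeasure θ), p y) ↔
      ∀ᵐ y : (ℝ ∙ θ)ᗮ ∂((stdOrthonormalBasis ℝ (ℝ ∙ θ)ᗮ).toBasis.addHaar), p y :=
  (MeasurableEmbedding.subtype_coe
    (Submodule.closed_of_finiteDimensional _).measurableSet).ae_map_iff

/-- Uniqueness of Haar measure; the value of `c` is irrelevant, since only null sets and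
integrability are transferred. -/
theorem exists_map_sliceEquiv_eq (hθ : ‖θ‖ = 1) : ∃ c : NNReal,
    Measure.map (sliceEquiv θ hθ)
      ((stdOrthonormalBasis ℝ (ℝ ∙ θ)ᗮ).toBasis.addHaar.prod volume) = c • volume :=
  ⟨_, Measure.isAddLeftInvariant_eq_smul _ _⟩

theorem ae_hyperplane_ae_of_ae (hθ : ‖θ‖ = 1) {p : E d → Prop} (h : ∀ᵐ x, p x) :
    ∀ᵐ y ∂(hyperplaneMeasure θ), ∀ᵐ r : ℝ, p (r • θ + y) := by
  obtain ⟨c, hc⟩ := exists_map_sliceEquiv_eq hθ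
  rw [ae_hyperplaneMeasure_iff]
  have h1 : ∀ᵐ x ∂(Measure.map (sliceEquiv θ hθ)
      ((stdOrthonormalBasis ℝ (ℝ ∙ θ)ᗮ).toBasis.addHaar.prod volume)), p x := by
    rw [hc]; exact Measure.ae_smul_measure h c
  exact Measure.ae_ae_of_ae_prod
    (ae_of_ae_map (sliceEquiv θ hθ).continuous.measurable.aemeasurable h1)

theorem ae_proj_of_ae_hyperplane (hθ : ‖θ‖ = 1) {p : E d → Prop}
    (h : ∀ᵐ y ∂(hyperplaneMeasure θ), p y) : ∀ᵐ x : E d, p (proj θ x) := by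
  rw [ae_hyperplaneMeasure_iff] at h
  have hc := Measure.isAddLeftInvariant_eq_smul
    (Measure.map (sliceEquiv θ hθ).symm (volume : Measure (E d)))
    ((stdOrthonormalBasis ℝ (ℝ ∙ θ)ᗮ).toBasis.addHaar.prod (volume : Measure ℝ))
  have h1 := Measure.ae_smul_measure (Measure.quasiMeasurePreserving_fst
    (ν := (volume : Measure ℝ)) |>.ae h)
    (Measure.addHaarScalarFactor (Measure.map (sliceEquiv θ hθ).symm (volume : Measure (E d)))
      ((stdOrthonormalBasis ℝ (ℝ ∙ θ)ᗮ).toBasis.addHaar.prod (volume : Measure ℝ)))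
  rw [← hc] at h1
  exact ae_of_ae_map (sliceEquiv θ hθ).symm.continuous.measurable.aemeasurable h1

theorem ae_hyperplane_integrable (hθ : ‖θ‖ = 1) {f : E d → ℝ} (hf : Integrable f) :
    ∀ᵐ y ∂(hyperplaneMeasure θ), Integrable fun r : ℝ => f (r • θ + y) := by
  obtain ⟨c, hc⟩ := exists_map_sliceEquiv_eq hθ
  rw [ae_hyperplaneMeasure_iff]
  have h1 := hf.smul_measure_nnreal (c := c)
  rw [← hc] at h1
  exact (h1.comp_measurable (sliceEquiv θ hθ).continuous.measurable).prod_right_ae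

theorem ae_hyperplane_memLp_two (hθ : ‖θ‖ = 1) {f : E d → ℝ} (hfm : Measurable f)
    (hf : MemLp f 2) :
    ∀ᵐ y ∂(hyperplaneMeasure θ), MemLp (fun r : ℝ => f (r • θ + y)) 2 := by
  filter_upwards [ae_hyperplane_integrable hθ hf.integrable_sq] with y hy
  rw [memLp_two_iff_integrable_sq]
  · exact hy
  · exact (hfm.comp (Continuous.measurable (by fun_prop))).aestronglyMeasurable

/-! ### Chords of a bounded open set -/

theorem exitTime_pos (hΩ : IsOpen Ω) (hb : Bornology.IsBounded Ω) (hθ : ‖θ‖ = 1) {x : E d}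
    (hx : x ∈ Ω) : 0 < exitTime Ω θ x := by
  obtain ⟨h0, -, h2⟩ := exitTime_spec hΩ hb hθ x
  refine h0.lt_of_ne fun h => h2 ?_
  simpa [← h] using hx

theorem mem_chordSet_of_nonneg (hΩ : IsOpen Ω) (hb : Bornology.IsBounded Ω) (hθ : ‖θ‖ = 1)
    {x : E d} {s : ℝ} (hs : 0 ≤ s) : s ∈ chordSet Ω θ x ↔ s < exitTime Ω θ x := by
  obtain ⟨h0, h1, h2⟩ := exitTime_spec hΩ hb hθ x
  refine ⟨fun h => ?_, fun h t ht => ?_⟩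
  · by_contra hc
    exact h2 (h _ (by rw [uIcc_of_le hs]; exact ⟨h0, not_lt.1 hc⟩))
  · rw [uIcc_of_le hs] at ht
    exact h1 t ⟨ht.1, ht.2.trans_lt h⟩

theorem neg_mem_chordSet_neg {x : E d} {s : ℝ} :
    -s ∈ chordSet Ω (-θ) x ↔ s ∈ chordSet Ω θ x := by
  have key : ∀ (θ : E d) (s : ℝ), s ∈ chordSet Ω θ x → -s ∈ chordSet Ω (-θ) x := by
    intro θ s h t ht
    have := h (-t) (by
      rw [mem_uIcc] at ht ⊢
      rcases ht with h | h <;> [right; left] <;> constructor <;> linarith [h.1, h.2])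
    simpa using this
  exact ⟨fun h => by simpa using key _ _ h, key θ s⟩

theorem chordSet_eq_Ioo (hΩ : IsOpen Ω) (hb : Bornology.IsBounded Ω) (hθ : ‖θ‖ = 1) {x : E d}
    (hx : x ∈ Ω) : chordSet Ω θ x = Ioo (-exitTime Ω (-θ) x) (exitTime Ω θ x) := by
  have hθ' : ‖-θ‖ = 1 := by rwa [norm_neg]
  have p1 := exitTime_pos hΩ hb hθ hx
  have p2 := exitTime_pos hΩ hb hθ' hx
  ext s
  rcases le_total 0 s with hs | hs
  · rw [mem_chordSet_of_nonneg hΩ hb hθ hs]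
    exact ⟨fun h => ⟨by linarith, h⟩, fun h => h.2⟩
  · rw [← neg_mem_chordSet_neg, mem_chordSet_of_nonneg hΩ hb hθ' (neg_nonneg.2 hs)]
    exact ⟨fun h => ⟨by linarith, by linarith⟩, fun h => by linarith [h.1]⟩

theorem volume_real_chordSet (hΩ : IsOpen Ω) (hb : Bornology.IsBounded Ω) (hθ : ‖θ‖ = 1)
    {x : E d} (hx : x ∈ Ω) :
    volume.real (chordSet Ω θ x) = exitTime Ω θ x + exitTime Ω (-θ) x := by
  have hθ' : ‖-θ‖ = 1 := by rwa [norm_neg]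
  have p1 := exitTime_pos hΩ hb hθ hx
  have p2 := exitTime_pos hΩ hb hθ' hx
  rw [chordSet_eq_Ioo hΩ hb hθ hx, Real.volume_real_Ioo_of_le (by linarith), sub_neg_eq_add]

theorem exitTime_add_smul (hΩ : IsOpen Ω) (hb : Bornology.IsBounded Ω) (hθ : ‖θ‖ = 1) {x : E d}
    {s : ℝ} (hs : s ∈ chordSet Ω θ x) : exitTime Ω θ (x + s • θ) = exitTime Ω θ x - s := by
  have hx := mem_of_mem_chordSet hs
  obtain ⟨-, h1, h2⟩ := exitTime_spec hΩ hb hθ x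
  have hs' := hs
  rw [chordSet_eq_Ioo hΩ hb hθ hx] at hs'
  refine exitTime_eq (by linarith [hs'.2]) (fun t ht => ?_) ?_
  · rw [add_assoc, ← add_smul]
    rcases le_total 0 (s + t) with h | h
    · exact h1 _ ⟨h, by linarith [ht.2]⟩
    · exact hs _ (by rw [mem_uIcc]; exact Or.inr ⟨by linarith [ht.1], h⟩)
  · rwa [add_assoc, ← add_smul, add_sub_cancel]

theorem exitPoint_add_smul (hΩ : IsOpen Ω) (hb : Bornology.IsBounded Ω) (hθ : ‖θ‖ = 1) {x : E d}
    {s : ℝ} (hs : s ∈ chordSet Ω θ x) : exitPoint Ω θ (x + s • θ) = exitPoint Ω θ x := by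
  rw [exitPoint, exitPoint, exitTime_add_smul hΩ hb hθ hs]
  module

theorem isOpen_slice (hΩ : IsOpen Ω) (θ y : E d) : IsOpen (slice Ω θ y) :=
  hΩ.preimage (f := fun s : ℝ => s • θ + y) (by fun_prop)

/-- Allows the averaging argument to be reused on a slice, an open subset of `ℝ` with direction `1`.
-/
theorem chordSet_slice (Ω : Set (E d)) (θ y : E d) (r : ℝ) :
    chordSet (slice Ω θ y) 1 r = chordSet Ω θ (r • θ + y) := by
  ext s
  refine forall₂_congr fun t _ => ?_
  rw [slice, mem_ofPred_eq, show (r + t • (1 : ℝ)) • θ + y = r • θ + y + t • θ by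
    rw [smul_eq_mul, mul_one]; module]

theorem isBounded_slice (hb : Bornology.IsBounded Ω) (hθ : ‖θ‖ = 1) (y : E d) :
    Bornology.IsBounded (slice Ω θ y) := by
  obtain ⟨R, hR⟩ := hb.exists_norm_le
  refine isBounded_iff_forall_norm_le.2 ⟨R + ‖y‖, fun s hs => ?_⟩
  have h1 := hR _ hs
  have h2 := norm_sub_le (s • θ + y) y
  rw [add_sub_cancel_right, norm_smul, hθ, mul_one] at h2
  linarith

theorem isComponentInterval_slice (hΩ : IsOpen Ω) (hb : Bornology.IsBounded Ω) (hθ : ‖θ‖ = 1)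
    {x : E d} (hx : x ∈ Ω) : IsComponentInterval (slice Ω θ (proj θ x))
      (⟪x, θ⟫ - exitTime Ω (-θ) x) (⟪x, θ⟫ + exitTime Ω θ x) := by
  have hθ' : ‖-θ‖ = 1 := by rwa [norm_neg]
  have p1 := exitTime_pos hΩ hb hθ hx
  have p2 := exitTime_pos hΩ hb hθ' hx
  have hmem : ∀ r : ℝ, r ∈ slice Ω θ (proj θ x) ↔ x + (r - ⟪x, θ⟫) • θ ∈ Ω := by
    intro r
    rw [slice, mem_ofPred_eq, proj, show r • θ + (x - ⟪x, θ⟫ • θ) = x + (r - ⟪x, θ⟫) • θ by module]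
  refine ⟨by linarith, fun r hr => ?_, ?_, ?_⟩
  · rw [hmem]
    refine add_smul_mem_of_mem_chordSet ?_
    rw [chordSet_eq_Ioo hΩ hb hθ hx]
    exact ⟨by linarith [hr.1], by linarith [hr.2]⟩
  · rw [hmem, sub_sub_cancel_left, neg_smul, ← smul_neg]
    exact (exitTime_spec hΩ hb hθ' x).2.2
  · rw [hmem, add_sub_cancel_left]
    exact (exitTime_spec hΩ hb hθ x).2.2

theorem exitTime_eq_of_isComponentInterval {y : E d} {α β r : ℝ}
    (h : IsComponentInterval (slice Ω θ y) α β) (hr : r ∈ Ioo α β) :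
    exitTime Ω θ (r • θ + y) = β - r ∧ exitTime Ω (-θ) (r • θ + y) = r - α := by
  obtain ⟨-, h1, h2, h3⟩ := h
  constructor
  · refine exitTime_eq (by linarith [hr.2]) (fun t ht => ?_) ?_
    · have : r + t ∈ slice Ω θ y := h1 ⟨by linarith [hr.1, ht.1], by linarith [ht.2]⟩
      rwa [slice, mem_ofPred_eq, show (r + t) • θ + y = r • θ + y + t • θ by module] at this
    · rwa [slice, mem_ofPred_eq, show β • θ + y = r • θ + y + (β - r) • θ by module] at h3
  · refine exitTime_eq (by linarith [hr.1]) (fun t ht => ?_) ?_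
    · have : r - t ∈ slice Ω θ y := h1 ⟨by linarith [ht.2], by linarith [hr.2, ht.1]⟩
      rwa [slice, mem_ofPred_eq, show (r - t) • θ + y = r • θ + y + t • -θ by module] at this
    · rwa [slice, mem_ofPred_eq, show α • θ + y = r • θ + y + (r - α) • -θ by module] at h2

/-- Leibniz' formula on a chord. -/
theorem integral_chordSet_of_isChordPrimitiveAt (hΩ : IsOpen Ω) (hb : Bornology.IsBounded Ω)
    (hθ : ‖θ‖ = 1) {f w g v : E d → ℝ} {x : E d} (hx : x ∈ Ω)
    (hf : IsChordPrimitiveAt Ω θ f w x) (hg : IsChordPrimitiveAt Ω θ g v x) :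
    ∫ s in chordSet Ω θ x, (f (x + s • θ) * v (x + s • θ) + g (x + s • θ) * w (x + s • θ)) =
      (f x + ∫ t in 0..exitTime Ω θ x, w (x + t • θ)) *
        (g x + ∫ t in 0..exitTime Ω θ x, v (x + t • θ)) -
      (f x + ∫ t in 0..(-exitTime Ω (-θ) x), w (x + t • θ)) *
        (g x + ∫ t in 0..(-exitTime Ω (-θ) x), v (x + t • θ)) := by
  have hθ' : ‖-θ‖ = 1 := by rwa [norm_neg]
  have p1 := exitTime_pos hΩ hb hθ hx
  have p2 := exitTime_pos hΩ hb hθ' hx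
  rw [← integral_mul_add_mul_of_primitives hf.intervalIntegrable hg.intervalIntegrable,
    intervalIntegral.integral_of_le (by linarith), integral_Ioc_eq_integral_Ioo,
    ← chordSet_eq_Ioo hΩ hb hθ hx]
  refine setIntegral_congr_ae (isOpen_chordSet hΩ θ x).measurableSet ?_
  filter_upwards [hf.ae_eq, hg.ae_eq] with s h1 h2 hs
  rw [h1 hs, h2 hs]

theorem chordAvg_eq_of_isChordPrimitiveAt (hΩ : IsOpen Ω) (hb : Bornology.IsBounded Ω)
    (hθ : ‖θ‖ = 1) {f w g v : E d → ℝ} {x : E d} (hx : x ∈ Ω)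
    (hf : IsChordPrimitiveAt Ω θ f w x) (hg : IsChordPrimitiveAt Ω θ g v x) :
    chordAvg Ω θ (fun z => f z * v z + g z * w z) x =
      ((f x + ∫ t in 0..exitTime Ω θ x, w (x + t • θ)) *
        (g x + ∫ t in 0..exitTime Ω θ x, v (x + t • θ)) -
      (f x + ∫ t in 0..(-exitTime Ω (-θ) x), w (x + t • θ)) *
        (g x + ∫ t in 0..(-exitTime Ω (-θ) x), v (x + t • θ))) /
      (exitTime Ω θ x + exitTime Ω (-θ) x) := by
  rw [chordAvg, integral_chordSet_of_isChordPrimitiveAt hΩ hb hθ hx hf hg,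
    volume_real_chordSet hΩ hb hθ hx, inv_mul_eq_div]

/-! ### Existence and value of the directional traces -/

section Trace

variable {f w : E d → ℝ}

/-- Makes the end value independent of the representative chosen in the definition of a trace. -/
theorem eq_right_of_ae_eq_Ioo {α β : ℝ} (hαβ : α < β) {f h₁ h₂ : ℝ → ℝ}
    (e₁ : h₁ =ᵐ[volume.restrict (Ioo α β)] f) (e₂ : h₂ =ᵐ[volume.restrict (Ioo α β)] f)
    (c₁ : ContinuousOn h₁ (Ioc α β)) (c₂ : ContinuousOn h₂ (Ioc α β)) : h₁ β = h₂ β := by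
  have h := e₁.trans e₂.symm
  rw [Measure.restrict_congr_set Ioo_ae_eq_Ioc] at h
  exact Measure.eqOn_Ioc_of_ae_eq volume h c₁ c₂ ⟨hαβ, le_rfl⟩

theorem IsChordPrimitiveAt.continuous_primitive {x : E d} (h : IsChordPrimitiveAt Ω θ f w x)
    (r₀ : ℝ) : Continuous fun r => f x + ∫ t in 0..(r - r₀), w (x + t • θ) :=
  continuous_const.add
    ((intervalIntegral.continuous_primitive h.intervalIntegrable 0).comp (by fun_prop))

theorem mem_chordSet_of_isComponentInterval (hΩ : IsOpen Ω) (hb : Bornology.IsBounded Ω)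
    (hθ : ‖θ‖ = 1) {y : E d} {α β r s : ℝ} (h : IsComponentInterval (slice Ω θ y) α β)
    (hr : r ∈ Ioo α β) (hs : s ∈ Ioo α β) : s - r ∈ chordSet Ω θ (r • θ + y) := by
  obtain ⟨h1, h2⟩ := exitTime_eq_of_isComponentInterval h hr
  rw [chordSet_eq_Ioo hΩ hb hθ (h.2.1 hr), h1, h2]
  exact ⟨by linarith [hs.1], by linarith [hs.2]⟩

theorem IsChordPrimitiveAt.ae_eq_Ioo (hΩ : IsOpen Ω) (hb : Bornology.IsBounded Ω)
    (hθ : ‖θ‖ = 1) {y : E d} {α β r₀ : ℝ} (hI : IsComponentInterval (slice Ω θ y) α β)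
    (hr₀ : r₀ ∈ Ioo α β) (h : IsChordPrimitiveAt Ω θ f w (r₀ • θ + y)) :
    (fun r => f (r₀ • θ + y) + ∫ t in 0..(r - r₀), w (r₀ • θ + y + t • θ))
      =ᵐ[volume.restrict (Ioo α β)] fun r => f (r • θ + y) := by
  rw [Filter.EventuallyEq, ae_restrict_iff' measurableSet_Ioo]
  have hq := (measurePreserving_sub_right (volume : Measure ℝ) r₀).quasiMeasurePreserving.ae h.ae_eq
  filter_upwards [hq] with r hr hrI
  rw [← hr (mem_chordSet_of_isComponentInterval hΩ hb hθ hI hr₀ hrI)]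
  congr 1
  module

/-- The value of a directional trace at the end of almost every chord. -/
theorem ae_dirTrace_exitPoint (hΩ : IsOpen Ω) (hb : Bornology.IsBounded Ω) (hθ : ‖θ‖ = 1)
    {u : L2 Ω} (hfu : f =ᵐ[volume.restrict Ω] u) (hf : ∀ᵐ x, IsChordPrimitiveAt Ω θ f w x)
    {g : E d → ℝ} (hg : g ∈ dirTrace Ω θ u) :
    ∀ᵐ x, x ∈ Ω →
      g (exitPoint Ω θ x) = f x + ∫ t in 0..exitTime Ω θ x, w (x + t • θ) := by
  obtain ⟨f', hf', A, -, hnull, hA⟩ := hg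
  have e1 : ∀ᵐ x, x ∈ Ω → f' x = f x :=
    (ae_restrict_iff' hΩ.measurableSet).1 (hf'.trans hfu.symm)
  have e2 : ∀ᵐ y ∂(hyperplaneMeasure θ), y ∈ proj θ '' Ω → y ∈ A := by
    rw [ae_iff]
    refine measure_mono_null (fun y hy => ?_) hnull
    rwa [mem_ofPred_eq, Classical.not_imp] at hy
  filter_upwards [hf, ae_ae_add_smul e1 θ, ae_proj_of_ae_hyperplane hθ e2] with x hx hx' hxA hxΩ
  have hθ' : ‖-θ‖ = 1 := by rwa [norm_neg]
  have p1 := exitTime_pos hΩ hb hθ hxΩ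
  have p2 := exitTime_pos hΩ hb hθ' hxΩ
  have hI := isComponentInterval_slice hΩ hb hθ hxΩ
  obtain ⟨h, h1, h2, h3⟩ := (hA _ (hxA ⟨x, hxΩ, rfl⟩)).2 _ _ hI
  have hr₀ : ⟪x, θ⟫ ∈ Ioo (⟪x, θ⟫ - exitTime Ω (-θ) x) (⟪x, θ⟫ + exitTime Ω θ x) :=
    ⟨by linarith, by linarith⟩
  have hxe := inner_smul_add_proj θ x
  have e3 := IsChordPrimitiveAt.ae_eq_Ioo hΩ hb hθ hI hr₀ (f := f) (w := w) (by rwa [hxe])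
  rw [hxe] at e3
  have e4 : (fun r => f (r • θ + proj θ x))
      =ᵐ[volume.restrict (Ioo (⟪x, θ⟫ - exitTime Ω (-θ) x) (⟪x, θ⟫ + exitTime Ω θ x))]
      fun r => f' (r • θ + proj θ x) := by
    rw [Filter.EventuallyEq, ae_restrict_iff' measurableSet_Ioo]
    have hq := (measurePreserving_sub_right (volume : Measure ℝ)
      ⟪x, θ⟫).quasiMeasurePreserving.ae hx'
    filter_upwards [hq] with r hr hrI
    have hre : x + (r - ⟪x, θ⟫) • θ = r • θ + proj θ x := by rw [proj]; module
    rw [hre] at hr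
    exact (hr (hI.2.1 hrI)).symm
  have := eq_right_of_ae_eq_Ioo hI.1 h1 (e3.trans e4) h2
    (hx.continuous_primitive _).continuousOn
  rw [add_sub_cancel_left] at this
  rw [← this, ← h3, exitPoint, proj]
  congr 1
  module

/-- The weak derivative is `w` on the line. A slice may have infinitely many components; instead of
summing over them, the integral of `f φ' + φ w` is replaced by that of its chord averages. Each
average vanishes by Leibniz' formula, as `φ` is zero at both ends of every component. -/
theorem memH1_slice (hΩ : IsOpen Ω) (hb : Bornology.IsBounded Ω) (hθ : ‖θ‖ = 1) {y : E d}
    (hy : ⟪y, θ⟫ = 0) (hf : MemLp (fun r : ℝ => f (r • θ + y)) 2)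
    (hw : MemLp (fun r : ℝ => w (r • θ + y)) 2)
    (h : ∀ᵐ r : ℝ, IsChordPrimitiveAt Ω θ f w (r • θ + y)) :
    MemH1 (slice Ω θ y) fun r => f (r • θ + y) := by
  refine ⟨hf.restrict _, fun r => w (r • θ + y), hw.restrict _, fun φ hφ => ?_⟩
  have hdc : Continuous (deriv φ) := hφ.1.continuous_deriv (by simp)
  have hφ2 : MemLp φ 2 := hφ.1.continuous.memLp_of_hasCompactSupport hφ.2.1
  have hdφ2 : MemLp (deriv φ) 2 := hdc.memLp_of_hasCompactSupport hφ.2.1.deriv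
  have i1 : Integrable fun r => f (r • θ + y) * deriv φ r := hf.integrable_mul hdφ2
  have i2 : Integrable fun r => w (r • θ + y) * φ r := hw.integrable_mul hφ2
  set G : ℝ → ℝ := fun r => f (r • θ + y) * deriv φ r + φ r * w (r • θ + y) with hG
  have hGi : Integrable G := by
    refine i1.add ?_
    simpa only [mul_comm] using i2
  have hS := isOpen_slice hΩ θ y
  have havg := (integral_chordAvg hS (isBounded_slice hb hθ y) one_ne_zero
    (hGi.integrableOn (s := slice Ω θ y))).2
  have hzero : ∀ r ∈ slice Ω θ y, chordAvg (slice Ω θ y) 1 G r = 0 := by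
    intro r hr
    -- The primitive property is known only almost everywhere on the line, so the base point moves
    -- along its chord to a good one; the average does not change.
    obtain ⟨s, hs, hps⟩ : ∃ s ∈ chordSet Ω θ (r • θ + y),
        IsChordPrimitiveAt Ω θ f w (s • θ + (r • θ + y)) := by
      have hq := (measurePreserving_add_right (volume : Measure ℝ) r).quasiMeasurePreserving.ae h
      by_contra! hc
      refine volume_chordSet_ne_zero hΩ (θ := θ) hr (measure_mono_null ?_ (ae_iff.1 hq))
      intro s hs hps
      refine hc s hs ?_
      rwa [add_smul, add_assoc] at hps
    have hs' : s ∈ chordSet (slice Ω θ y) 1 r := by rwa [chordSet_slice]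
    rw [← chordAvg_add_smul hS G hs', smul_eq_mul, mul_one, chordAvg, chordSet_slice]
    set x := (r + s) • θ + y with hx
    have hxr : s • θ + (r • θ + y) = x := by rw [hx]; module
    rw [hxr] at hps
    have hxΩ : x ∈ Ω := by
      have := add_smul_mem_of_mem_chordSet hs
      rwa [add_comm, hxr] at this
    have hxθ : ⟪x, θ⟫ = r + s := inner_smul_add hθ hy _
    have hin : ∀ t : ℝ, ⟪x + t • θ, θ⟫ = r + s + t := by
      intro t
      rw [inner_add_left, real_inner_smul_left, inner_self_of_norm_eq_one hθ, hxθ, mul_one]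
    -- `φ` is extended to `ℝ^d`, constant across the line, to fit the chord form of Leibniz'
    -- formula.
    have hφp : IsChordPrimitiveAt Ω θ (fun z => φ ⟪z, θ⟫) (fun z => deriv φ ⟪z, θ⟫) x := by
      refine ⟨fun a b => ?_, Filter.Eventually.of_forall fun t _ => ?_⟩
      · simp only [hin]
        exact (hdc.comp (by fun_prop)).intervalIntegrable _ _
      · simp only [hin, hxθ]
        rw [intervalIntegral.integral_comp_add_left (deriv φ), intervalIntegral.integral_deriv_eq_sub
          (fun z _ => hφ.1.differentiable (by simp) z) (hdc.intervalIntegrable _ _)]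
        ring_nf
    have key := integral_chordSet_of_isChordPrimitiveAt hΩ hb hθ hxΩ hps hφp
    have hprim : ∀ b : ℝ, φ ⟪x, θ⟫ + ∫ t in 0..b, deriv φ ⟪x + t • θ, θ⟫ = φ (r + s + b) := by
      intro b
      simp only [hin, hxθ]
      rw [intervalIntegral.integral_comp_add_left (deriv φ), intervalIntegral.integral_deriv_eq_sub
        (fun z _ => hφ.1.differentiable (by simp) z) (hdc.intervalIntegrable _ _)]
      ring_nf
    have hout : ∀ b : ℝ, x + b • θ ∉ Ω → φ (r + s + b) = 0 := by
      intro b hbΩ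
      refine image_eq_zero_of_notMem_tsupport fun hm => hbΩ ?_
      have := hφ.2.2 hm
      rwa [slice, mem_ofPred_eq, show (r + s + b) • θ + y = x + b • θ by rw [hx]; module] at this
    have hθ' : ‖-θ‖ = 1 := by rwa [norm_neg]
    rw [hprim, hprim, hout _ (exitTime_spec hΩ hb hθ x).2.2, hout, mul_zero, mul_zero,
      sub_zero] at key
    · rw [mul_eq_zero]
      right
      convert key using 3 with t
      simp only [hG, hin, smul_eq_mul, mul_one]
      rw [show (r + s + t) • θ + y = x + t • θ by rw [hx]; module]
    · rw [neg_smul, ← smul_neg]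
      exact (exitTime_spec hΩ hb hθ' x).2.2
  rw [setIntegral_congr_fun hS.measurableSet hzero, integral_zero, hG, integral_add i1.restrict
    (by simpa only [mul_comm] using i2.restrict)] at havg
  simp only [mul_comm (φ _)] at havg
  linarith

theorem dirTrace_nonempty (hΩ : IsOpen Ω) (hb : Bornology.IsBounded Ω) (hθ : ‖θ‖ = 1)
    {u : L2 Ω} (hfu : f =ᵐ[volume.restrict Ω] u) (hfm : Measurable f) (hwm : Measurable w)
    (hf : MemLp f 2) (hw : MemLp w 2) (hfw : ∀ᵐ x, IsChordPrimitiveAt Ω θ f w x) :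
    (dirTrace Ω θ u).Nonempty := by
  -- At most one value is imposed at `z`: the component ending there is unique, and so is the end
  -- value of a continuous representative. Where nothing is imposed, the value is `0`.
  have hg : ∀ z : E d, ∃ c : ℝ, ∀ (α : ℝ) (h : ℝ → ℝ),
      IsComponentInterval (slice Ω θ (proj θ z)) α ⟪z, θ⟫ →
      h =ᵐ[volume.restrict (Ioo α ⟪z, θ⟫)] (fun s => f (s • θ + proj θ z)) →
      ContinuousOn h (Ioc α ⟪z, θ⟫) → c = h ⟪z, θ⟫ := by
    intro z
    by_cases hz : ∃ (α : ℝ) (h : ℝ → ℝ), IsComponentInterval (slice Ω θ (proj θ z)) α ⟪z, θ⟫ ∧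
      h =ᵐ[volume.restrict (Ioo α ⟪z, θ⟫)] (fun s => f (s • θ + proj θ z)) ∧
      ContinuousOn h (Ioc α ⟪z, θ⟫)
    · obtain ⟨α, h, h1, h2, h3⟩ := hz
      refine ⟨h ⟪z, θ⟫, fun α' h' h1' h2' h3' => ?_⟩
      have hα : α = α' := by
        refine le_antisymm ?_ ?_ <;> by_contra! hc
        · exact h1.2.2.1 (h1'.2.1 ⟨hc, h1.1⟩)
        · exact h1'.2.2.1 (h1.2.1 ⟨hc, h1'.1⟩)
      subst hα
      exact eq_right_of_ae_eq_Ioo h1.1 h2 h2' h3 h3'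
    · exact ⟨0, fun α h h1 h2 h3 => absurd ⟨α, h, h1, h2, h3⟩ hz⟩
  choose g hg using hg
  refine ⟨g, f, hfu, {y | y ∈ proj θ '' Ω ∧ MemH1 (slice Ω θ y) (fun s => f (s • θ + y)) ∧
    ∀ᵐ r : ℝ, IsChordPrimitiveAt Ω θ f w (r • θ + y)}, fun y hy => hy.1, ?_, ?_⟩
  · have : ∀ᵐ y ∂(hyperplaneMeasure θ), y ∈ proj θ '' Ω →
        MemH1 (slice Ω θ y) (fun s => f (s • θ + y)) ∧
          ∀ᵐ r : ℝ, IsChordPrimitiveAt Ω θ f w (r • θ + y) := by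
      filter_upwards [ae_hyperplane_memLp_two hθ hfm hf, ae_hyperplane_memLp_two hθ hwm hw,
        ae_hyperplane_ae_of_ae hθ hfw] with y h1 h2 h3 hy
      obtain ⟨x, -, rfl⟩ := hy
      exact ⟨memH1_slice hΩ hb hθ (inner_proj hθ x) h1 h2 h3, h3⟩
    refine measure_mono_null ?_ (ae_iff.1 this)
    intro y hy
    rw [mem_ofPred_eq, Classical.not_imp]
    exact ⟨hy.1, fun hc => hy.2 ⟨hy.1, hc⟩⟩
  · rintro y ⟨⟨x, -, rfl⟩, hH, hp⟩
    refine ⟨hH, fun α β hI => ?_⟩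
    obtain ⟨r₀, hr₀, hpr⟩ : ∃ r₀ ∈ Ioo α β, IsChordPrimitiveAt Ω θ f w (r₀ • θ + proj θ x) := by
      by_contra! hc
      exact (Measure.measure_Ioo_pos volume |>.2 hI.1).ne'
        (measure_mono_null (fun r hr => hc r hr) (ae_iff.1 hp))
    have e := IsChordPrimitiveAt.ae_eq_Ioo hΩ hb hθ hI hr₀ hpr
    have c := (hpr.continuous_primitive r₀).continuousOn (s := Ioc α β)
    refine ⟨_, e, c, ?_⟩
    have hz := hg (β • θ + proj θ x)
    rw [inner_smul_add hθ (inner_proj hθ x), proj_smul_add hθ (inner_proj hθ x)] at hz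
    exact hz α _ hI e c

end Trace

/-! ### The directional measure -/

theorem measurable_exitTime (hΩ : IsOpen Ω) (hb : Bornology.IsBounded Ω) (hθ : ‖θ‖ = 1) :
    Measurable (exitTime Ω θ) := by
  refine measurable_of_Ioi fun r => IsOpen.measurableSet ?_
  rcases lt_or_ge r 0 with hr | hr
  · convert isOpen_univ
    exact eq_univ_of_forall fun x => hr.trans_le (exitTime_spec hΩ hb hθ x).1
  · have : exitTime Ω θ ⁻¹' Ioi r = {x | r ∈ chordSet Ω θ x} :=
      Set.ext fun x => (mem_chordSet_of_nonneg hΩ hb hθ hr).symm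
    rw [this]
    exact isOpen_setOf_mem_chordSet_left hΩ θ r

theorem exitPoint_mem_frontier (hΩ : IsOpen Ω) (hb : Bornology.IsBounded Ω) (hθ : ‖θ‖ = 1)
    {x : E d} (hx : x ∈ Ω) : exitPoint Ω θ x ∈ frontier Ω := by
  obtain ⟨-, h1, h2⟩ := exitTime_spec hΩ hb hθ x
  have hpos := exitTime_pos hΩ hb hθ hx
  rw [hΩ.frontier_eq]
  refine ⟨?_, h2⟩
  have hc : Continuous fun t : ℝ => x + t • θ := by fun_prop
  refine map_mem_closure hc (s := Ico 0 (exitTime Ω θ x)) ?_ h1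
  rw [closure_Ico hpos.ne]
  exact right_mem_Icc.2 hpos.le

theorem restrict_frontier_dirMeasure (hΩ : IsOpen Ω) (hb : Bornology.IsBounded Ω)
    (hθ : ‖θ‖ = 1) : (dirMeasure Ω θ).restrict (frontier Ω) = dirMeasure Ω θ := by
  refine Measure.restrict_eq_self_of_ae_mem ?_
  rw [dirMeasure]
  refine (ae_map_iff (p := fun z => z ∈ frontier Ω) (aemeasurable_exitPoint hΩ hb hθ)
    isClosed_frontier.measurableSet).2 ?_
  rw [ae_restrict_iff' hΩ.measurableSet]
  exact Filter.Eventually.of_forall fun x hx => exitPoint_mem_frontier hΩ hb hθ hx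

theorem stronglyMeasurable_chordAvg (hΩ : IsOpen Ω) {G : E d → ℝ} (hG : StronglyMeasurable G) :
    StronglyMeasurable (chordAvg Ω θ G) := by
  have hC := (isOpen_setOf_mem_chordSet hΩ θ).measurableSet
  have h1 : Measurable fun x => volume.real (chordSet Ω θ x) :=
    (measurable_measure_prodMk_left hC).ennreal_toReal
  have h2 : StronglyMeasurable fun p : E d × ℝ => G (p.1 + p.2 • θ) :=
    hG.comp_measurable (Continuous.measurable (by fun_prop))
  have h3 := (h2.indicator hC).integral_prod_right' (ν := (volume : Measure ℝ))
  refine h1.inv.stronglyMeasurable.mul ?_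
  convert h3 using 2 with x
  rw [← integral_indicator (isOpen_chordSet hΩ θ x).measurableSet]
  rfl

/-- The sequence is eventually constant: a small step back from the end stays on the chord. The
points used depend only on the end point, so the limit reads the chord value of `H` from the
boundary. -/
theorem tendsto_comp_sub_smul_exitPoint (hΩ : IsOpen Ω) (hb : Bornology.IsBounded Ω)
    (hθ : ‖θ‖ = 1) {H : E d → ℝ}
    (hH : ∀ x, ∀ s ∈ chordSet Ω θ x, H (x + s • θ) = H x) {x : E d} (hx : x ∈ Ω) :
    Filter.Tendsto (fun n : ℕ => H (exitPoint Ω θ x - (1 / ((n : ℝ) + 1)) • θ)) Filter.atTop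
      (nhds (H x)) := by
  refine tendsto_const_nhds.congr' ?_
  have h0 := tendsto_one_div_add_atTop_nhds_zero_nat (𝕜 := ℝ)
  filter_upwards [h0.eventually (gt_mem_nhds (exitTime_pos hΩ hb hθ hx))] with n hn
  have hpos : 0 < 1 / ((n : ℝ) + 1) := by positivity
  have hs : exitTime Ω θ x - 1 / ((n : ℝ) + 1) ∈ chordSet Ω θ x := by
    rw [mem_chordSet_of_nonneg hΩ hb hθ (by linarith)]
    linarith
  rw [← hH x _ hs, exitPoint]
  congr 1
  module

/-- The set of the points of `∂_θ Ω` is Borel and carries the directional measure. -/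
theorem ae_dirMeasure_exists_exitPoint (hΩ : IsOpen Ω) (hb : Bornology.IsBounded Ω)
    (hθ : ‖θ‖ = 1) : ∀ᵐ z ∂(dirMeasure Ω θ), ∃ x ∈ Ω, exitPoint Ω θ x = z := by
  have hm := measurable_exitTime hΩ hb hθ
  -- Ends of chords are detected by stepping back `1 / (n + 1)` for some `n`, a countable union of
  -- Borel conditions.
  have hM : MeasurableSet {z : E d | ∃ n : ℕ, z - (1 / ((n : ℝ) + 1)) • θ ∈ Ω ∧
      exitTime Ω θ (z - (1 / ((n : ℝ) + 1)) • θ) = 1 / ((n : ℝ) + 1)} := by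
    simp only [ofPred_exists]
    refine MeasurableSet.iUnion fun n => ?_
    have hc : Measurable fun z : E d => z - (1 / ((n : ℝ) + 1)) • θ := by fun_prop
    exact (hc hΩ.measurableSet).inter (measurableSet_eq_fun (hm.comp hc) measurable_const)
  have h : ∀ᵐ z ∂(dirMeasure Ω θ), ∃ n : ℕ, z - (1 / ((n : ℝ) + 1)) • θ ∈ Ω ∧
      exitTime Ω θ (z - (1 / ((n : ℝ) + 1)) • θ) = 1 / ((n : ℝ) + 1) := by
    rw [dirMeasure, ae_map_iff (aemeasurable_exitPoint hΩ hb hθ) hM,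
      ae_restrict_iff' hΩ.measurableSet]
    refine Filter.Eventually.of_forall fun x hx => ?_
    obtain ⟨n, hn⟩ := exists_nat_one_div_lt (exitTime_pos hΩ hb hθ hx)
    refine ⟨n, ?_⟩
    have hpos : 0 < 1 / ((n : ℝ) + 1) := by positivity
    have hs : exitTime Ω θ x - 1 / ((n : ℝ) + 1) ∈ chordSet Ω θ x := by
      rw [mem_chordSet_of_nonneg hΩ hb hθ (by linarith)]
      linarith
    have he : exitPoint Ω θ x - (1 / ((n : ℝ) + 1)) • θ =
        x + (exitTime Ω θ x - 1 / ((n : ℝ) + 1)) • θ := by rw [exitPoint]; module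
    rw [he, exitTime_add_smul hΩ hb hθ hs]
    exact ⟨add_smul_mem_of_mem_chordSet hs, by ring⟩
  filter_upwards [h] with z hz
  obtain ⟨n, h1, h2⟩ := hz
  exact ⟨_, h1, by rw [exitPoint, h2, sub_add_cancel]⟩

theorem ae_dirMeasure_proj (hΩ : IsOpen Ω) (hb : Bornology.IsBounded Ω) (hθ : ‖θ‖ = 1)
    {p : E d → Prop} (h : ∀ᵐ y ∂(hyperplaneMeasure θ), p y) :
    ∀ᵐ z ∂(dirMeasure Ω θ), p (proj θ z) := by
  -- Passing through an image measure requires a measurable exceptional set.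
  obtain ⟨N, hN, hNm, hN0⟩ := exists_measurable_superset_of_null (ae_iff.1 h)
  have hpc : Measurable (proj θ : E d → E d) :=
    Continuous.measurable (by unfold proj; fun_prop)
  have h1 : ∀ᵐ z ∂(dirMeasure Ω θ), proj θ z ∈ Nᶜ := by
    rw [dirMeasure, ae_map_iff (aemeasurable_exitPoint hΩ hb hθ) (hpc hNm.compl)]
    refine ae_restrict_of_ae ?_
    filter_upwards [ae_proj_of_ae_hyperplane hθ (measure_eq_zero_iff_ae_notMem.1 hN0)] with x hx
    rwa [exitPoint, proj_add_smul hθ]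
  filter_upwards [h1] with z hz
  by_contra hc
  exact hz (hN hc)

/-- A function on `∂_θ Ω` that corresponds to a measurable function on `Ω` is measurable for the
directional measure, if the function on `Ω` is constant on every chord. -/
theorem aestronglyMeasurable_dirMeasure (hΩ : IsOpen Ω) (hb : Bornology.IsBounded Ω)
    (hθ : ‖θ‖ = 1) {F H : E d → ℝ} (hHm : StronglyMeasurable H)
    (hH : ∀ x, ∀ s ∈ chordSet Ω θ x, H (x + s • θ) = H x)
    (hFH : ∀ᵐ x, x ∈ Ω → F (exitPoint Ω θ x) = H x) :
    AEStronglyMeasurable F (dirMeasure Ω θ) := by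
  -- On almost every line the identity holds at every point of `Ω`: both sides are constant on
  -- chords, and each chord, of positive length, contains a good point.
  have h1 : ∀ᵐ y ∂(hyperplaneMeasure θ), ∀ x ∈ Ω, proj θ x = y →
      F (exitPoint Ω θ x) = H x := by
    filter_upwards [ae_hyperplane_ae_of_ae hθ hFH] with y hy x hx hxy
    have hq := (measurePreserving_add_right (volume : Measure ℝ)
      ⟪x, θ⟫).quasiMeasurePreserving.ae hy
    obtain ⟨s, hs, hps⟩ : ∃ s ∈ chordSet Ω θ x, F (exitPoint Ω θ (x + s • θ)) = H (x + s • θ) := by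
      by_contra! hc
      refine volume_chordSet_ne_zero hΩ (θ := θ) hx (measure_mono_null ?_ (ae_iff.1 hq))
      intro s hs hps
      have he : (s + ⟪x, θ⟫) • θ + y = x + s • θ := by rw [← hxy, proj]; module
      rw [he] at hps
      exact hc s hs (hps (add_smul_mem_of_mem_chordSet hs))
    rwa [exitPoint_add_smul hΩ hb hθ hs, hH x s hs] at hps
  -- Measurability of `F` composed with `exitPoint` would not suffice for the image measure, hence
  -- the explicit approximation.
  refine aestronglyMeasurable_of_tendsto_ae Filter.atTop
    (f := fun (n : ℕ) z => H (z - (1 / ((n : ℝ) + 1)) • θ)) (fun n => ?_) ?_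
  · exact (hHm.comp_measurable (by fun_prop)).aestronglyMeasurable
  · filter_upwards [ae_dirMeasure_exists_exitPoint hΩ hb hθ, ae_dirMeasure_proj hΩ hb hθ h1]
      with z ⟨x, hx, hxz⟩ hz
    have hp : proj θ x = proj θ z := by rw [← hxz, exitPoint, proj_add_smul hθ]
    rw [← hxz, hz x hx hp]
    exact tendsto_comp_sub_smul_exitPoint hΩ hb hθ hH hx

/-! ### The integration-by-parts formula -/

theorem HasWeakDirDeriv.indicator (hΩ : IsOpen Ω) {u w : L2 Ω} (h : HasWeakDirDeriv Ω θ u w)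
    {φ : E d → ℝ} (hφ : IsTestFunction Ω φ) :
    ∫ x, Ω.indicator u x * fderiv ℝ φ x θ = -∫ x, Ω.indicator w x * φ x := by
  have hmul : ∀ (v : L2 Ω) (ψ : E d → ℝ), (fun x => Ω.indicator v x * ψ x) =
      Ω.indicator fun x => v x * ψ x := fun v ψ => by
    ext x
    by_cases hx : x ∈ Ω <;> simp [hx]
  rw [hmul _ fun x => fderiv ℝ φ x θ, hmul _ φ, integral_indicator hΩ.measurableSet, integral_indicator hΩ.measurableSet]
  exact h φ hφ

theorem memLp_indicator (hΩ : IsOpen Ω) (u : L2 Ω) : MemLp (Ω.indicator u) 2 :=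
  (memLp_indicator_iff_restrict hΩ.measurableSet).2 (Lp.memLp u)

theorem integrable_indicator_L2 (hΩ : IsOpen Ω) (hb : Bornology.IsBounded Ω) (u : L2 Ω) :
    Integrable (Ω.indicator u) := by
  have : IsFiniteMeasure ((volume : Measure (E d)).restrict Ω) :=
    ⟨by rw [Measure.restrict_apply_univ]; exact hb.measure_lt_top⟩
  exact (integrable_indicator_iff hΩ.measurableSet).2 ((Lp.memLp u).integrable (by norm_num))

theorem stronglyMeasurable_indicator (hΩ : IsOpen Ω) (u : L2 Ω) :
    StronglyMeasurable (Ω.indicator u) :=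
  (Lp.stronglyMeasurable u).indicator hΩ.measurableSet

theorem HasWeakDirDeriv.ae_isChordPrimitiveAt (hΩ : IsOpen Ω) (hb : Bornology.IsBounded Ω)
    (hθ : ‖θ‖ = 1) {u w : L2 Ω} (h : HasWeakDirDeriv Ω θ u w) :
    ∀ᵐ x, IsChordPrimitiveAt Ω θ (Ω.indicator u) (Ω.indicator w) x :=
  DirectionalTrace.ae_isChordPrimitiveAt hΩ (norm_ne_zero_iff.1 (hθ ▸ one_ne_zero))
    (integrable_indicator_L2 hΩ hb u) (stronglyMeasurable_indicator hΩ u).measurable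
    (integrable_indicator_L2 hΩ hb w) (stronglyMeasurable_indicator hΩ w)
    fun _ hφ => h.indicator hΩ hφ

theorem integral_neg_comp_smul_neg (w : E d → ℝ) (x : E d) (b : ℝ) :
    ∫ t in 0..b, -w (x + t • -θ) = ∫ t in 0..(-b), w (x + t • θ) := by
  have h := intervalIntegral.integral_comp_neg (fun t => w (x + t • θ)) (a := 0) (b := b)
  rw [neg_zero] at h
  rw [intervalIntegral.integral_neg, intervalIntegral.integral_symm (-b) 0, ← h]
  simp

/-- Reversing the chord changes the sign of the derivative; the results for traces in the direction
`θ` thus apply to `-θ`. -/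
theorem IsChordPrimitiveAt.neg {f w : E d → ℝ} {x : E d} (h : IsChordPrimitiveAt Ω θ f w x) :
    IsChordPrimitiveAt Ω (-θ) f (fun z => -w z) x := by
  refine ⟨fun a b => ?_, ?_⟩
  · have := (h.intervalIntegrable (-a) (-b)).comp_sub_left 0
    have h' : IntervalIntegrable (fun t => w (x + t • -θ)) volume a b := by simpa using this
    exact h'.neg
  · have hq := (Measure.measurePreserving_neg (volume : Measure ℝ)).quasiMeasurePreserving.ae h.ae_eq
    filter_upwards [hq] with s hs hsc
    rw [← neg_mem_chordSet_neg, neg_neg] at hs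
    have e : x + s • -θ = x + -s • θ := by module
    rw [e, hs hsc, integral_neg_comp_smul_neg]

/-- The mean value on the chord through `x` of the derivative of the product of two functions, in
terms of their directional traces. -/
theorem ae_dirTrace_eq_chordAvg (hΩ : IsOpen Ω) (hb : Bornology.IsBounded Ω) (hθ : ‖θ‖ = 1)
    {u v wu wv : L2 Ω} (hu : HasWeakDirDeriv Ω θ u wu) (hv : HasWeakDirDeriv Ω θ v wv)
    {gu gu' gv gv' : E d → ℝ} (hgu : gu ∈ dirTrace Ω θ u) (hgu' : gu' ∈ dirTrace Ω (-θ) u)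
    (hgv : gv ∈ dirTrace Ω θ v) (hgv' : gv' ∈ dirTrace Ω (-θ) v) :
    ∀ᵐ x, x ∈ Ω →
      (gu (exitPoint Ω θ x) * gv (exitPoint Ω θ x) -
        gu' (oppositePoint Ω θ (exitPoint Ω θ x)) * gv' (oppositePoint Ω θ (exitPoint Ω θ x))) /
          chordLength Ω θ (exitPoint Ω θ x) =
      chordAvg Ω θ (fun z => Ω.indicator u z * Ω.indicator wv z +
        Ω.indicator v z * Ω.indicator wu z) x := by
  have hθ' : ‖-θ‖ = 1 := by rwa [norm_neg]
  have pu := hu.ae_isChordPrimitiveAt hΩ hb hθ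
  have pv := hv.ae_isChordPrimitiveAt hΩ hb hθ
  have hae : ∀ w : L2 Ω, Ω.indicator w =ᵐ[volume.restrict Ω] w := fun w =>
    indicator_ae_eq_restrict hΩ.measurableSet
  filter_upwards [pu, pv, ae_dirTrace_exitPoint hΩ hb hθ (hae u) pu hgu,
    ae_dirTrace_exitPoint hΩ hb hθ (hae v) pv hgv,
    ae_dirTrace_exitPoint hΩ hb hθ' (hae u) (pu.mono fun _ h => h.neg) hgu',
    ae_dirTrace_exitPoint hΩ hb hθ' (hae v) (pv.mono fun _ h => h.neg) hgv']
    with x hxu hxv h1 h2 h3 h4 hx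
  rw [oppositePoint_exitPoint hΩ hb hθ hx, chordLength_exitPoint hΩ hb hθ hx, h1 hx, h2 hx, h3 hx,
    h4 hx, integral_neg_comp_smul_neg, integral_neg_comp_smul_neg,
    chordAvg_eq_of_isChordPrimitiveAt hΩ hb hθ hx hxu hxv]

theorem dirTrace_nonempty_of_mem_W (hΩ : IsOpen Ω) (hb : Bornology.IsBounded Ω) (hθ : ‖θ‖ = 1)
    {u : L2 Ω} (hu : u ∈ W Ω θ) :
    (dirTrace Ω θ u).Nonempty ∧ (dirTrace Ω (-θ) u).Nonempty := by
  have hθ' : ‖-θ‖ = 1 := by rwa [norm_neg]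
  obtain ⟨w, hw⟩ := hu
  have p := hw.ae_isChordPrimitiveAt hΩ hb hθ
  have hae : Ω.indicator u =ᵐ[volume.restrict Ω] u := indicator_ae_eq_restrict hΩ.measurableSet
  have hum := (stronglyMeasurable_indicator hΩ u).measurable
  have hwm := (stronglyMeasurable_indicator hΩ w).measurable
  exact ⟨dirTrace_nonempty hΩ hb hθ hae hum hwm (memLp_indicator hΩ u) (memLp_indicator hΩ w) p,
    dirTrace_nonempty hΩ hb hθ' hae hum hwm.neg (memLp_indicator hΩ u) (memLp_indicator hΩ w).neg
      (p.mono fun _ h => h.neg)⟩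

end DirectionalTrace

end

theorem mainTheorem3 (d : ℕ) (Ω : Set (DirectionalTrace.E d)) (hΩ : IsOpen Ω)
    (hb : Bornology.IsBounded Ω) (θ : DirectionalTrace.E d) (hθ : ‖θ‖ = 1)
    (u v : DirectionalTrace.L2 Ω)
    (hu : u ∈ DirectionalTrace.W Ω θ) (hv : v ∈ DirectionalTrace.W Ω θ) :
    ((DirectionalTrace.dirTrace Ω θ u).Nonempty ∧ (DirectionalTrace.dirTrace Ω (-θ) u).Nonempty ∧
      (DirectionalTrace.dirTrace Ω θ v).Nonempty ∧
      (DirectionalTrace.dirTrace Ω (-θ) v).Nonempty) ∧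
    ∀ gu ∈ DirectionalTrace.dirTrace Ω θ u, ∀ gu' ∈ DirectionalTrace.dirTrace Ω (-θ) u,
    ∀ gv ∈ DirectionalTrace.dirTrace Ω θ v, ∀ gv' ∈ DirectionalTrace.dirTrace Ω (-θ) v,
      IntegrableOn (fun x => u x * DirectionalTrace.dirDeriv Ω θ v x +
        v x * DirectionalTrace.dirDeriv Ω θ u x) Ω ∧
      IntegrableOn (fun z => (gu z * gv z -
        gu' (DirectionalTrace.oppositePoint Ω θ z) * gv' (DirectionalTrace.oppositePoint Ω θ z)) /
          DirectionalTrace.chordLength Ω θ z) (frontier Ω) (DirectionalTrace.dirMeasure Ω θ) ∧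
      ∫ x in Ω, (u x * DirectionalTrace.dirDeriv Ω θ v x +
          v x * DirectionalTrace.dirDeriv Ω θ u x) =
        ∫ z in frontier Ω, (gu z * gv z -
          gu' (DirectionalTrace.oppositePoint Ω θ z) *
            gv' (DirectionalTrace.oppositePoint Ω θ z)) /
          DirectionalTrace.chordLength Ω θ z ∂(DirectionalTrace.dirMeasure Ω θ) := by
  have hnu := DirectionalTrace.dirTrace_nonempty_of_mem_W hΩ hb hθ hu
  have hnv := DirectionalTrace.dirTrace_nonempty_of_mem_W hΩ hb hθ hv
  refine ⟨⟨hnu.1, hnu.2, hnv.1, hnv.2⟩, fun gu hgu gu' hgu' gv hgv gv' hgv' => ?_⟩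
  have hθ0 : θ ≠ 0 := norm_ne_zero_iff.1 (hθ ▸ one_ne_zero)
  set wu := DirectionalTrace.dirDeriv Ω θ u
  set wv := DirectionalTrace.dirDeriv Ω θ v
  set G : DirectionalTrace.E d → ℝ := fun z => Ω.indicator u z * Ω.indicator wv z +
    Ω.indicator v z * Ω.indicator wu z with hG
  have hGe : EqOn G (fun x => u x * wv x + v x * wu x) Ω := fun x hx => by simp [hG, hx]
  have hGm : StronglyMeasurable G := by
    have := fun w => DirectionalTrace.stronglyMeasurable_indicator hΩ w
    exact ((this u).mul (this wv)).add ((this v).mul (this wu))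
  have hi : IntegrableOn (fun x => u x * wv x + v x * wu x) Ω :=
    ((Lp.memLp u).integrable_mul (Lp.memLp wv)).add ((Lp.memLp v).integrable_mul (Lp.memLp wu))
  obtain ⟨h1, h2⟩ := DirectionalTrace.integral_chordAvg hΩ hb hθ0
    (hi.congr_fun hGe.symm hΩ.measurableSet)
  set F : DirectionalTrace.E d → ℝ := fun z => (gu z * gv z -
    gu' (DirectionalTrace.oppositePoint Ω θ z) * gv' (DirectionalTrace.oppositePoint Ω θ z)) /
      DirectionalTrace.chordLength Ω θ z with hF
  have hFG : ∀ᵐ x, x ∈ Ω → F (DirectionalTrace.exitPoint Ω θ x) =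
      DirectionalTrace.chordAvg Ω θ G x :=
    DirectionalTrace.ae_dirTrace_eq_chordAvg hΩ hb hθ (DirectionalTrace.dirDeriv_spec hu)
      (DirectionalTrace.dirDeriv_spec hv) hgu hgu' hgv hgv'
  have hFm : AEStronglyMeasurable F (DirectionalTrace.dirMeasure Ω θ) :=
    DirectionalTrace.aestronglyMeasurable_dirMeasure hΩ hb hθ
      (DirectionalTrace.stronglyMeasurable_chordAvg hΩ hGm)
      (fun _ _ hs => DirectionalTrace.chordAvg_add_smul hΩ G hs) hFG
  have hΦ := DirectionalTrace.aemeasurable_exitPoint hΩ hb hθ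
  have hae : (fun x => F (DirectionalTrace.exitPoint Ω θ x)) =ᵐ[volume.restrict Ω]
      DirectionalTrace.chordAvg Ω θ G := (ae_restrict_iff' hΩ.measurableSet).2 hFG
  refine ⟨hi, ?_, ?_⟩
  · rw [IntegrableOn, DirectionalTrace.restrict_frontier_dirMeasure hΩ hb hθ,
      DirectionalTrace.dirMeasure, integrable_map_measure hFm hΦ]
    exact h1.congr hae.symm
  -- Pulled back to `Ω`, the boundary integrand is the chord average of `G`, whose integral is that
  -- of `G`.
  · rw [DirectionalTrace.restrict_frontier_dirMeasure hΩ hb hθ, DirectionalTrace.dirMeasure,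
      integral_map hΦ hFm, integral_congr_ae hae, h2]
    exact setIntegral_congr_fun hΩ.measurableSet hGe.symm
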